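/- Let $A=(a_{ij})\in\mathbb Z^{d\times n}$ be a matrix whose columns $a_1,\dots,a_n$ are nonzero, generate $\mathbb Z^d$ as a group, and generate a cone in $\mathbb R^d$ that contains no line. Let $D$ be the complex Weyl algebra in $x_1,\dots,x_n,\partial_1,\dots,\partial_n$ and $R=\mathbb C[\partial_1,\dots,\partial_n]\subset D$, both $\mathbb Z^d$-graded by $\deg\partial_j=-a_j$, $\deg x_j=a_j$ (the $A$-grading). Put $E_k=\sum_j a_{kj}x_j\partial_j$ for $k=1,\dots,d$, and let $\beta\in\mathbb C^d$. For an $A$-graded $R$-module $V$, the quasidegree set $\operatorname{qdeg}(V)$ is the Zariski closure in $\mathbb C^d$ of $\{\alpha\in\mathbb Z^d: V_\alpha\ne 0\}$. The Euler–Koszul homology $\mathcal H_i(E-\beta,V)$ is the $i$-th homology of the Koszul complex on the $D$-module $D\otimes_R V$ of the commuting $D$-linear endomorphisms that send a homogeneous element $y$ of degree $\alpha$ to $(E_k-\beta_k-\alpha_k)\,y$, $k=1,\dots,d$. For an ideal $I\subseteq R$ put $M_A(I,\beta)=D/\bigl(DI+\sum_k D(E_k-\beta_k)\bigr)$. A binomial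 is a polynomial with at most two terms, and a binomial ideal is an ideal generated by binomials. For $J\subseteq\{1,\dots,n\}$, a saturated sublattice $\Lambda\subseteq\mathbb Z^J\subseteq\mathbb Z^n$ and a homomorphism $\rho:\Lambda\to\mathbb C^*$, let $I_{\rho,J}=\langle \partial^{u_+}-\rho(u)\partial^{u_-}: u\in\Lambda\rangle+\langle\partial_j: j\notin J\rangle$, where $u=u_+-u_-$ with $u_\pm\in\mathbb N^n$ of disjoint supports. Let $I\subseteq R$ be an $A$-graded binomial ideal, and fix an irredundant primary decomposition $I=\bigcap_{I_{\rho,J}\in\operatorname{Ass}(I)}C_{\rho,J}$ into $A$-graded binomial ideals, with $C_{\rho,J}$ being $I_{\rho,J}$-primary. The component $C_{\rho,J}$ is called Andean if $\dim(R/I_{\rho,J})\neq\operatorname{rank}(A_J)$, where $A_J$ consists of the columns of $A$ indexed by $J$, and $\mathcal Z_{\rm Andean}(I)$ is the union of the sets $\operatorname{qdeg}(R/C_{\rho,J})$ over the Andean components. Let $I_\beta$ be the intersection of those components $C_{\rho,J}$ for which $-\beta\in\operatorname{qdeg}(R/C_{\rho,J})$ (so $I_\beta=R$ if there are none). If $-\beta\notin\mathcal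 Z_{\rm Andean}(I)$, then the natural surjection $R/I\twoheadrightarrow R/I_\beta$ induces isomorphisms of left $D$-modules $\mathcal H_i(E-\beta,R/I)\cong\mathcal H_i(E-\beta,R/I_\beta)$ for all $i$. In particular, the natural surjection $M_A(I,\beta)\to M_A(I_\beta,\beta)$ is an isomorphism. -/

import Mathlib

open MvPolynomial
open scoped TensorProduct

namespace EulerKoszul

noncomputable section

/-! ### The polynomial ring and the Weyl algebra -/

/-- The polynomial ring `R = ℂ[∂₁, …, ∂ₙ]`; the variable `X j` is `∂ⱼ`. -/
abbrev R (n : ℕ) : Type := MvPolynomial (Fin n) ℂ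

/-- The free generators: `Sum.inl j` stands for `xⱼ` and `Sum.inr j` for `∂ⱼ`. -/
abbrev Gen (n : ℕ) : Type := Fin n ⊕ Fin n

/-- The defining relations of the Weyl algebra. -/
inductive WeylRel (n : ℕ) : FreeAlgebra ℂ (Gen n) → FreeAlgebra ℂ (Gen n) → Prop
  | x_comm (i j : Fin n) : WeylRel n
      (FreeAlgebra.ι ℂ (Sum.inl i) * FreeAlgebra.ι ℂ (Sum.inl j))
      (FreeAlgebra.ι ℂ (Sum.inl j) * FreeAlgebra.ι ℂ (Sum.inl i))
  | del_comm (i j : Fin n) : WeylRel n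
      (FreeAlgebra.ι ℂ (Sum.inr i) * FreeAlgebra.ι ℂ (Sum.inr j))
      (FreeAlgebra.ι ℂ (Sum.inr j) * FreeAlgebra.ι ℂ (Sum.inr i))
  | del_x (i j : Fin n) : WeylRel n
      (FreeAlgebra.ι ℂ (Sum.inr i) * FreeAlgebra.ι ℂ (Sum.inl j))
      (FreeAlgebra.ι ℂ (Sum.inl j) * FreeAlgebra.ι ℂ (Sum.inr i) + if i = j then 1 else 0)

/-- The complex Weyl algebra `D` in the variables `x₁, …, xₙ`. -/
def Weyl (n : ℕ) : Type := RingQuot (WeylRel n)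

instance (n : ℕ) : Ring (Weyl n) := inferInstanceAs (Ring (RingQuot (WeylRel n)))

instance (n : ℕ) : Algebra ℂ (Weyl n) := inferInstanceAs (Algebra ℂ (RingQuot (WeylRel n)))

namespace Weyl

variable {n : ℕ}

/-- The quotient map from the free algebra. -/
def mk : FreeAlgebra ℂ (Gen n) →ₐ[ℂ] Weyl n := RingQuot.mkAlgHom ℂ (WeylRel n)

/-- The generator `xⱼ` of `D`. -/
def x (j : Fin n) : Weyl n := mk (FreeAlgebra.ι ℂ (Sum.inl j))

/-- The generator `∂ⱼ` of `D`. -/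
def del (j : Fin n) : Weyl n := mk (FreeAlgebra.ι ℂ (Sum.inr j))

theorem mk_eq {a b : FreeAlgebra ℂ (Gen n)} (h : WeylRel n a b) : mk a = mk b :=
  RingQuot.mkAlgHom_rel ℂ h

theorem x_comm (i j : Fin n) : x i * x j = x j * x i := by
  simpa [x] using mk_eq (WeylRel.x_comm i j)

theorem del_comm (i j : Fin n) : del i * del j = del j * del i := by
  simpa [del] using mk_eq (WeylRel.del_comm i j)

theorem del_x (i j : Fin n) : del i * x j = x j * del i + if i = j then 1 else 0 := by
  have h := mk_eq (WeylRel.del_x i j)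
  rw [map_mul, map_add, map_mul] at h
  refine h.trans ?_
  congr 1
  split_ifs <;> simp

theorem isMulCommutative_adjoin_del :
    IsMulCommutative (Algebra.adjoin ℂ (Set.range (del : Fin n → Weyl n))) := by
  apply Algebra.isMulCommutative_adjoin
  rintro _ ⟨i, rfl⟩ _ ⟨j, rfl⟩
  exact del_comm i j

open scoped IsMulCommutative in
/-- The homomorphism `R → D` sending `X j` to `∂ⱼ`. -/
def ofPoly : R n →ₐ[ℂ] Weyl n :=
  haveI := isMulCommutative_adjoin_del (n := n)
  (Algebra.adjoin ℂ (Set.range (del : Fin n → Weyl n))).val.comp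
    (MvPolynomial.aeval fun j => ⟨del j, Algebra.subset_adjoin ⟨j, rfl⟩⟩)

@[simp] theorem ofPoly_X (j : Fin n) : ofPoly (X j) = del j := by
  simp [ofPoly]

/-- `D` as a (right) `R`-module: `r` acts by right multiplication. -/
instance : Module (R n) (Weyl n) where
  smul r a := a * ofPoly r
  one_smul a := by change a * ofPoly 1 = a; simp
  mul_smul r s a := by
    change a * ofPoly (r * s) = (a * ofPoly s) * ofPoly r
    rw [mul_comm r s, map_mul, mul_assoc]
  smul_zero r := zero_mul _
  smul_add r a b := add_mul _ _ _
  add_smul r s a := by change a * ofPoly (r + s) = a * ofPoly r + a * ofPoly s; rw [map_add, mul_add]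
  zero_smul a := by change a * ofPoly 0 = 0; simp

theorem smul_def (r : R n) (a : Weyl n) : r • a = a * ofPoly r := rfl

instance : IsScalarTower ℂ (R n) (Weyl n) where
  smul_assoc c r a := by simp [smul_def]

instance : SMulCommClass (R n) (Weyl n) (Weyl n) where
  smul_comm r a b := by simp [smul_def, mul_assoc]

instance : SMulCommClass (R n) ℂ (Weyl n) where
  smul_comm r c b := by simp [smul_def]

end Weyl

/-! ### `A`-graded modules, quasidegrees -/

variable {d n : ℕ}

/-- An `A`-grading of an `R`-module `V`: a decomposition `V = ⨁ V_α` over `α ∈ ℤᵈ` such that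
`∂ⱼ V_α ⊆ V_{α - aⱼ}`, where `aⱼ` is the `j`-th column of `A` (that is, `deg ∂ⱼ = -aⱼ`). -/
structure AGrading (A : Matrix (Fin d) (Fin n) ℤ) (V : Type) [AddCommGroup V] [Module ℂ V]
    [Module (R n) V] where
  piece : (Fin d → ℤ) → Submodule ℂ V
  isInternal : DirectSum.IsInternal piece
  X_smul_mem : ∀ (j : Fin n) (α : Fin d → ℤ) (v : V), v ∈ piece α →
    (X j : R n) • v ∈ piece (α - A.col j)

/-- The Zariski closure in `ℂᵈ` of a set of points. -/
def zariskiClosure (S : Set (Fin d → ℂ)) : Set (Fin d → ℂ) :=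
  zeroLocus ℂ (vanishingIdeal ℂ S)

/-- The inclusion `ℤᵈ ⊆ ℂᵈ`. -/
def toComplex (α : Fin d → ℤ) : Fin d → ℂ := fun i => (α i : ℂ)

namespace AGrading

variable {A : Matrix (Fin d) (Fin n) ℤ} {V : Type} [AddCommGroup V] [Module ℂ V] [Module (R n) V]

/-- The true degrees of a graded module. -/
def tdeg (G : AGrading A V) : Set (Fin d → ℤ) := {α | G.piece α ≠ ⊥}

/-- The quasidegrees of a graded module. -/
def qdeg (G : AGrading A V) : Set (Fin d → ℂ) := zariskiClosure (toComplex '' G.tdeg)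

/-- The `ℂ`-linear map `V → V` that multiplies `v ∈ V_α` by `αᵢ`. -/
def degMap (G : AGrading A V) (i : Fin d) : V →ₗ[ℂ] V :=
  (DirectSum.toModule ℂ (Fin d → ℤ) V fun α => ((α i : ℤ) : ℂ) • (G.piece α).subtype) ∘ₗ
    (LinearEquiv.ofBijective (DirectSum.coeLinearMap G.piece) G.isInternal).symm.toLinearMap

theorem degMap_of_mem (G : AGrading A V) (i : Fin d) {α : Fin d → ℤ} {v : V}
    (hv : v ∈ G.piece α) : G.degMap i v = ((α i : ℤ) : ℂ) • v := by
  have h : (LinearEquiv.ofBijective (DirectSum.coeLinearMap G.piece) G.isInternal).symm v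
      = DirectSum.lof ℂ (Fin d → ℤ) (fun α => G.piece α) α ⟨v, hv⟩ := by
    rw [LinearEquiv.symm_apply_eq]
    exact (DirectSum.coeLinearMap_lof G.piece α (⟨v, hv⟩ : G.piece α)).symm
  simp only [degMap, LinearMap.comp_apply, LinearEquiv.coe_coe, h, DirectSum.toModule_lof]
  rfl

theorem induction_on (G : AGrading A V) (p : V → Prop) (v : V) (h0 : p 0)
    (hadd : ∀ u w, p u → p w → p (u + w)) (hmem : ∀ α, ∀ u ∈ G.piece α, p u) : p v := by
  have hv : v ∈ ⨆ α, G.piece α := by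
    rw [G.isInternal.submodule_iSup_eq_top]; trivial
  exact Submodule.iSup_induction G.piece (motive := p) hv hmem h0 hadd

theorem degMap_X_smul (G : AGrading A V) [IsScalarTower ℂ (R n) V] (i : Fin d) (j : Fin n)
    (v : V) : G.degMap i ((X j : R n) • v)
      = (X j : R n) • G.degMap i v - ((A i j : ℤ) : ℂ) • (X j : R n) • v := by
  have := IsScalarTower.to_smulCommClass' (R := ℂ) (A := R n) (M := V)
  refine G.induction_on (fun v => G.degMap i ((X j : R n) • v)
      = (X j : R n) • G.degMap i v - ((A i j : ℤ) : ℂ) • (X j : R n) • v) v ?_ ?_ ?_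
  · simp
  · intro u w hu hw
    simp only [smul_add, map_add, hu, hw]
    abel
  · intro α u hu
    rw [degMap_of_mem G i hu, degMap_of_mem G i (G.X_smul_mem j α u hu), smul_comm (X j : R n)]
    simp [sub_smul, Matrix.col]

theorem degMap_comm (G : AGrading A V) (i k : Fin d) (v : V) :
    G.degMap i (G.degMap k v) = G.degMap k (G.degMap i v) := by
  refine G.induction_on (fun v => G.degMap i (G.degMap k v) = G.degMap k (G.degMap i v)) v
    ?_ ?_ ?_
  · simp
  · intro u w hu hw
    simp only [map_add, hu, hw]
  · intro α u hu
    simp only [degMap_of_mem G _ hu, map_smul, smul_smul, mul_comm]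

end AGrading

/-! ### Euler operators -/

/-- The Euler operator `Eᵢ = ∑ⱼ aᵢⱼ xⱼ ∂ⱼ`. -/
def euler (A : Matrix (Fin d) (Fin n) ℤ) (i : Fin d) : Weyl n :=
  ∑ j, ((A i j : ℤ) : ℂ) • (Weyl.x j * Weyl.del j)

/-- The operator `Eᵢ - βᵢ`. -/
def eulerSub (A : Matrix (Fin d) (Fin n) ℤ) (β : Fin d → ℂ) (i : Fin d) : Weyl n :=
  euler A i - algebraMap ℂ (Weyl n) (β i)

theorem euler_mul_x (A : Matrix (Fin d) (Fin n) ℤ) (i : Fin d) (k : Fin n) :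
    euler A i * Weyl.x k = Weyl.x k * euler A i + ((A i k : ℤ) : ℂ) • Weyl.x k := by
  have h : ∀ j : Fin n, Weyl.x j * Weyl.del j * Weyl.x k
      = Weyl.x k * (Weyl.x j * Weyl.del j) + if j = k then Weyl.x j else 0 := by
    intro j
    rw [mul_assoc, Weyl.del_x, mul_add, ← mul_assoc, Weyl.x_comm j k, mul_assoc]
    split_ifs <;> simp
  simp [euler, Finset.sum_mul, Finset.mul_sum, h, Finset.sum_add_distrib, smul_add]

theorem del_mul_euler (A : Matrix (Fin d) (Fin n) ℤ) (i : Fin d) (k : Fin n) :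
    Weyl.del k * euler A i = euler A i * Weyl.del k + ((A i k : ℤ) : ℂ) • Weyl.del k := by
  have h : ∀ j : Fin n, Weyl.del k * (Weyl.x j * Weyl.del j)
      = Weyl.x j * Weyl.del j * Weyl.del k + if k = j then Weyl.del j else 0 := by
    intro j
    rw [← mul_assoc, Weyl.del_x, add_mul, mul_assoc, Weyl.del_comm k j, mul_assoc]
    split_ifs <;> simp
  simp [euler, Finset.sum_mul, Finset.mul_sum, h, Finset.sum_add_distrib, smul_add]

theorem euler_comm (A : Matrix (Fin d) (Fin n) ℤ) (i k : Fin d) :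
    euler A i * euler A k = euler A k * euler A i := by
  have h : ∀ j : Fin n, euler A i * (Weyl.x j * Weyl.del j)
      = Weyl.x j * Weyl.del j * euler A i := by
    intro j
    rw [← mul_assoc, euler_mul_x, mul_assoc (Weyl.x j) (Weyl.del j), del_mul_euler]
    simp [mul_add, add_mul, mul_assoc]
  conv_lhs => rw [euler.eq_def A k]
  conv_rhs => rw [euler.eq_def A k]
  simp [Finset.sum_mul, Finset.mul_sum, h]

theorem eulerSub_comm (A : Matrix (Fin d) (Fin n) ℤ) (β : Fin d → ℂ) (i k : Fin d) :
    eulerSub A β i * eulerSub A β k = eulerSub A β k * eulerSub A β i := by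
  have h1 := Algebra.commutes (β i) (euler A k)
  have h2 := Algebra.commutes (β k) (euler A i)
  have h3 := Algebra.commutes (β i) (algebraMap ℂ (Weyl n) (β k))
  simp only [eulerSub, sub_mul, mul_sub, euler_comm A i k, h1, h2, h3]
  abel

section EulerEnd

set_option linter.unusedSectionVars false

variable {A : Matrix (Fin d) (Fin n) ℤ} {V : Type} [AddCommGroup V] [Module ℂ V] [Module (R n) V]
  [IsScalarTower ℂ (R n) V]

/-- The biadditive map `(a, v) ↦ a (Eᵢ - βᵢ) ⊗ v - a ⊗ degᵢ(v)`. -/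
def eulerAux (β : Fin d → ℂ) (G : AGrading A V) (i : Fin d) :
    Weyl n →+ V →+ Weyl n ⊗[R n] V :=
  AddMonoidHom.mk' (fun a => AddMonoidHom.mk'
      (fun v => (a * eulerSub A β i) ⊗ₜ[R n] v - a ⊗ₜ[R n] G.degMap i v)
      (fun u v => by simp only [TensorProduct.tmul_add, map_add]; abel))
    (fun a b => by
      ext v
      simp only [AddMonoidHom.mk'_apply, AddMonoidHom.add_apply, TensorProduct.add_tmul, add_mul]
      abel)

theorem eulerAux_apply (β : Fin d → ℂ) (G : AGrading A V) (i : Fin d) (a : Weyl n) (v : V) :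
    eulerAux β G i a v = (a * eulerSub A β i) ⊗ₜ[R n] v - a ⊗ₜ[R n] G.degMap i v := rfl

theorem eulerAux_balanced (β : Fin d → ℂ) (G : AGrading A V) (i : Fin d) (r : R n) :
    ∀ (a : Weyl n) (v : V), eulerAux β G i (r • a) v = eulerAux β G i a (r • v) := by
  induction r using MvPolynomial.induction_on with
  | C c =>
    intro a v
    have h1 : (C c : R n) • a = c • a := by
      rw [← MvPolynomial.algebraMap_eq, algebraMap_smul]
    have h2 : (C c : R n) • v = c • v := by
      rw [← MvPolynomial.algebraMap_eq, algebraMap_smul]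
    simp only [h1, h2, eulerAux_apply, map_smul, smul_mul_assoc, TensorProduct.smul_tmul]
  | add p q hp hq =>
    intro a v
    simp only [add_smul, map_add, AddMonoidHom.add_apply, hp, hq]
  | mul_X p j hp =>
    intro a v
    rw [mul_smul, hp, mul_comm p, mul_smul]
    generalize p • v = w
    have h1 : (X j : R n) • a = a * Weyl.del j := by simp [Weyl.smul_def]
    have h2 : ∀ (b : Weyl n) (u : V),
        b ⊗ₜ[R n] ((X j : R n) • u) = (b * Weyl.del j) ⊗ₜ[R n] u := by
      intro b u
      rw [← TensorProduct.smul_tmul]; simp [Weyl.smul_def]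
    have h3 : a * Weyl.del j * eulerSub A β i
        = a * eulerSub A β i * Weyl.del j + ((A i j : ℤ) : ℂ) • (a * Weyl.del j) := by
      have h4 := Algebra.commutes (β i) (Weyl.del j)
      simp only [eulerSub, mul_assoc, mul_sub, sub_mul, del_mul_euler, mul_add, h4,
        mul_smul_comm]
      abel
    have h5 : a ⊗ₜ[R n] (((A i j : ℤ) : ℂ) • ((X j : R n) • w))
        = (((A i j : ℤ) : ℂ) • (a * Weyl.del j)) ⊗ₜ[R n] w := by
      rw [TensorProduct.tmul_smul, h2, TensorProduct.smul_tmul']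
    rw [h1, eulerAux_apply, eulerAux_apply, G.degMap_X_smul, TensorProduct.tmul_sub, h2, h2, h5,
      h3, TensorProduct.add_tmul]
    abel

/-- The `D`-linear endomorphism `Eᵢ - βᵢ` of `D ⊗_R V` given by
`a ⊗ v ↦ a (Eᵢ - βᵢ) ⊗ v - a ⊗ degᵢ(v)`. For the induced `A`-grading of `D ⊗_R V`
(with `deg xⱼ = aⱼ`, `deg ∂ⱼ = -aⱼ`) it sends a homogeneous element `y` of degree `α` to
`(Eᵢ - βᵢ - αᵢ) y`; see `eulerEnd_of_mem`. -/
def eulerEnd (β : Fin d → ℂ) (G : AGrading A V) (i : Fin d) :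
    Module.End (Weyl n) (Weyl n ⊗[R n] V) where
  toFun := TensorProduct.liftAddHom (eulerAux β G i) (eulerAux_balanced β G i)
  map_add' := map_add _
  map_smul' b t := by
    induction t using TensorProduct.induction_on with
    | zero => simp
    | tmul a v =>
      simp [TensorProduct.smul_tmul', eulerAux_apply, smul_sub, mul_assoc]
    | add s t hs ht =>
      simp only [RingHom.id_apply] at hs ht ⊢
      simp only [smul_add, map_add, hs, ht]

theorem eulerEnd_tmul (β : Fin d → ℂ) (G : AGrading A V) (i : Fin d) (a : Weyl n) (v : V) :
    eulerEnd β G i (a ⊗ₜ[R n] v)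
      = (a * eulerSub A β i) ⊗ₜ[R n] v - a ⊗ₜ[R n] G.degMap i v := rfl

theorem eulerEnd_comm (β : Fin d → ℂ) (G : AGrading A V) (i k : Fin d) :
    Commute (eulerEnd β G i) (eulerEnd β G k) := by
  refine LinearMap.ext fun t => ?_
  simp only [Module.End.mul_apply]
  induction t using TensorProduct.induction_on with
  | zero => simp
  | tmul a v =>
    simp only [eulerEnd_tmul, map_sub, mul_assoc, eulerSub_comm A β i k, G.degMap_comm i k]
    abel
  | add s t hs ht => simp only [map_add, hs, ht]

/-- The degree `γ` part of `D`, spanned by the `x^u ∂^w` with `A u - A w = γ`. -/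
def weylPiece (A : Matrix (Fin d) (Fin n) ℤ) (γ : Fin d → ℤ) : Submodule ℂ (Weyl n) :=
  Submodule.span ℂ {a | ∃ u w : Fin n → ℕ,
    (A.mulVec (fun j => (u j : ℤ)) - A.mulVec (fun j => (w j : ℤ)) = γ) ∧
    a = (List.ofFn fun j => Weyl.x j ^ u j).prod * (List.ofFn fun j => Weyl.del j ^ w j).prod}

/-- The degree `α` part of `D ⊗_R V`, spanned by the `a ⊗ v` with `a`, `v` homogeneous
and `deg a + deg v = α`. -/
def tensorPiece (G : AGrading A V) (α : Fin d → ℤ) : Submodule ℂ (Weyl n ⊗[R n] V) :=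
  Submodule.span ℂ {y | ∃ (γ δ : Fin d → ℤ) (a : Weyl n) (v : V),
    a ∈ weylPiece A γ ∧ v ∈ G.piece δ ∧ γ + δ = α ∧ y = a ⊗ₜ[R n] v}

theorem euler_mul_x_pow (i : Fin d) (j : Fin n) (m : ℕ) :
    euler A i * Weyl.x j ^ m
      = Weyl.x j ^ m * euler A i + (((A i j : ℤ) : ℂ) * m) • Weyl.x j ^ m := by
  induction m with
  | zero => simp
  | succ m ih =>
    rw [pow_succ, ← mul_assoc, ih, add_mul, mul_assoc, euler_mul_x]
    simp only [mul_add, smul_mul_assoc, mul_smul_comm, mul_assoc, add_assoc, ← add_smul]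
    congr 2
    push_cast
    ring

theorem euler_mul_del_pow (i : Fin d) (j : Fin n) (m : ℕ) :
    euler A i * Weyl.del j ^ m
      = Weyl.del j ^ m * euler A i + (-((A i j : ℤ) : ℂ) * m) • Weyl.del j ^ m := by
  have h : euler A i * Weyl.del j = Weyl.del j * euler A i + (-((A i j : ℤ) : ℂ)) • Weyl.del j := by
    rw [del_mul_euler, neg_smul]; abel
  induction m with
  | zero => simp
  | succ m ih =>
    rw [pow_succ, ← mul_assoc, ih, add_mul, mul_assoc, h]
    simp only [mul_add, smul_mul_assoc, mul_smul_comm, mul_assoc, add_assoc, ← add_smul]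
    congr 2
    push_cast
    ring

theorem euler_mul_list_prod (i : Fin d) (l : List (Weyl n × ℂ))
    (hl : ∀ q ∈ l, euler A i * q.1 = q.1 * euler A i + q.2 • q.1) :
    euler A i * (l.map Prod.fst).prod
      = (l.map Prod.fst).prod * euler A i + (l.map Prod.snd).sum • (l.map Prod.fst).prod := by
  induction l with
  | nil => simp
  | cons q l ih =>
    have h1 := hl q (by simp)
    have h2 := ih (fun p hp => hl p (by simp [hp]))
    simp only [List.map_cons, List.prod_cons, List.sum_cons]
    rw [← mul_assoc, h1, add_mul, mul_assoc, h2]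
    simp only [mul_add, smul_mul_assoc, mul_smul_comm, mul_assoc, add_assoc, ← add_smul]
    rw [add_comm q.2]

theorem euler_mul_ofFn (i : Fin d) (f : Fin n → Weyl n) (c : Fin n → ℂ)
    (h : ∀ j, euler A i * f j = f j * euler A i + c j • f j) :
    euler A i * (List.ofFn f).prod
      = (List.ofFn f).prod * euler A i + (∑ j, c j) • (List.ofFn f).prod := by
  have := euler_mul_list_prod (A := A) i (List.ofFn fun j => (f j, c j)) (by
    intro q hq
    obtain ⟨j, rfl⟩ := (List.mem_ofFn' _ _).1 hq
    exact h j)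
  simpa [List.map_ofFn, Function.comp_def, List.sum_ofFn] using this

theorem euler_mul_of_mem (i : Fin d) {γ : Fin d → ℤ} {a : Weyl n} (ha : a ∈ weylPiece A γ) :
    euler A i * a = a * euler A i + ((γ i : ℤ) : ℂ) • a := by
  induction ha using Submodule.span_induction with
  | mem a ha =>
    obtain ⟨u, w, rfl, rfl⟩ := ha
    have h1 := euler_mul_ofFn (A := A) i _ _ fun j => euler_mul_x_pow (A := A) i j (u j)
    have h2 := euler_mul_ofFn (A := A) i _ _ fun j => euler_mul_del_pow (A := A) i j (w j)
    rw [← mul_assoc, h1, add_mul, mul_assoc, h2]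
    simp only [mul_add, smul_mul_assoc, mul_smul_comm, mul_assoc, add_assoc, ← add_smul]
    congr 2
    simp [Matrix.mulVec, dotProduct]
    ring
  | zero => simp
  | add a b _ _ ha hb => rw [mul_add, ha, hb, add_mul, smul_add]; abel
  | smul c a _ ha => rw [mul_smul_comm, ha, smul_add, smul_mul_assoc, smul_comm c]

/-- On the degree `α` part of `D ⊗_R V`, the endomorphism `Eᵢ - βᵢ` is `y ↦ (Eᵢ - βᵢ - αᵢ) y`. -/
theorem eulerEnd_of_mem (β : Fin d → ℂ) (G : AGrading A V) (i : Fin d) {α : Fin d → ℤ}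
    {y : Weyl n ⊗[R n] V} (hy : y ∈ tensorPiece G α) :
    eulerEnd β G i y
      = (euler A i - algebraMap ℂ (Weyl n) (β i) - algebraMap ℂ (Weyl n) ((α i : ℤ) : ℂ)) • y := by
  induction hy using Submodule.span_induction with
  | mem y hy =>
    obtain ⟨γ, δ, a, v, ha, hv, rfl, rfl⟩ := hy
    have h1 := euler_mul_of_mem i ha
    have h2 := Algebra.commutes (β i) a
    rw [eulerEnd_tmul, G.degMap_of_mem i hv, TensorProduct.smul_tmul', smul_eq_mul,
      TensorProduct.tmul_smul, TensorProduct.smul_tmul', ← TensorProduct.sub_tmul]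
    congr 1
    simp only [eulerSub, sub_mul, mul_sub, h1, h2, ← Algebra.smul_def, Pi.add_apply, Int.cast_add,
      add_smul]
    abel
  | zero => simp
  | add y z _ _ hy hz => rw [map_add, hy, hz, smul_add]
  | smul c y _ hy =>
    have h : ∀ z : Weyl n ⊗[R n] V, c • z = algebraMap ℂ (Weyl n) c • z :=
      fun z => (algebraMap_smul (Weyl n) c z).symm
    rw [h, map_smul, hy, smul_smul, smul_smul, Algebra.commutes]

end EulerEnd

/-! ### The Koszul complex of commuting endomorphisms -/

section Koszul

open CategoryTheory

variable {S : Type} [Ring S] {N N' : Type} [AddCommGroup N] [Module S N] [AddCommGroup N']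
  [Module S N']

/-- The sign `(-1)^{#{k ∈ T : k < j}}`. -/
def koszulSign (j : Fin d) (T : Finset (Fin d)) : ℤ := (-1) ^ (T.filter (· < j)).card

theorem koszulSign_insert_of_lt {j k : Fin d} {T : Finset (Fin d)} (hj : j ∉ T) (h : j < k) :
    koszulSign k (insert j T) = -koszulSign k T := by
  rw [koszulSign, koszulSign, Finset.filter_insert, if_pos h, Finset.card_insert_of_notMem
    (fun hm => hj (Finset.mem_filter.1 hm).1), pow_succ]
  ring

theorem koszulSign_insert_of_not_lt {j k : Fin d} {T : Finset (Fin d)} (h : ¬ j < k) :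
    koszulSign k (insert j T) = koszulSign k T := by
  rw [koszulSign, koszulSign, Finset.filter_insert, if_neg h]

/-- The Koszul differential of `φ₁, …, φ_d` on `N ⊗ Λ(ℤᵈ)`. An element `∑_T f(T) ⊗ e_T`, with
`e_T = e_{t₁} ∧ ⋯ ∧ e_{t_p}` for `T = {t₁ < ⋯ < t_p}`, is written as the function `f`, and
`m ⊗ e_T ↦ ∑_k (-1)^{k-1} φ_{t_k}(m) ⊗ e_{T \ t_k}`. -/
def koszulDiff (φ : Fin d → Module.End S N) :
    (Finset (Fin d) → N) →ₗ[S] (Finset (Fin d) → N) :=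
  LinearMap.pi fun T => ∑ j ∈ Tᶜ, koszulSign j T • (φ j ∘ₗ LinearMap.proj (insert j T))

theorem koszulDiff_apply (φ : Fin d → Module.End S N) (f : Finset (Fin d) → N)
    (T : Finset (Fin d)) :
    koszulDiff φ f T = ∑ j ∈ Tᶜ, koszulSign j T • φ j (f (insert j T)) := by
  simp [koszulDiff]

theorem koszulDiff_koszulDiff (φ : Fin d → Module.End S N) (hφ : ∀ i j, Commute (φ i) (φ j))
    (f : Finset (Fin d) → N) : koszulDiff φ (koszulDiff φ f) = 0 := by
  ext T
  simp only [koszulDiff_apply, map_sum, Finset.smul_sum, Pi.zero_apply, map_zsmul, smul_smul]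
  rw [Finset.sum_sigma']
  refine Finset.sum_involution (fun q _ => ⟨q.2, q.1⟩) ?_ ?_ ?_ ?_
  · rintro ⟨j, k⟩ h
    simp only [Finset.mem_sigma, Finset.mem_compl, Finset.mem_insert, not_or] at h
    obtain ⟨hj, hkj, hk⟩ := h
    have hc : φ k (φ j (f (insert j (insert k T)))) = φ j (φ k (f (insert k (insert j T)))) := by
      rw [Finset.insert_comm]
      exact LinearMap.congr_fun (hφ k j) _
    simp only [hc, ← add_smul]
    convert zero_smul ℤ _
    rcases lt_or_gt_of_ne hkj with h | h
    · rw [koszulSign_insert_of_lt hk h, koszulSign_insert_of_not_lt h.le.not_gt]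
      ring
    · rw [koszulSign_insert_of_lt hj h, koszulSign_insert_of_not_lt h.le.not_gt]
      ring
  · rintro ⟨j, k⟩ h _ he
    simp only [Finset.mem_sigma, Finset.mem_compl, Finset.mem_insert, not_or] at h
    simp only [Sigma.mk.injEq, heq_eq_eq] at he
    exact h.2.1 he.1
  · rintro ⟨j, k⟩ h
    simp only [Finset.mem_sigma, Finset.mem_compl, Finset.mem_insert, not_or] at h ⊢
    exact ⟨h.2.2, fun e => h.2.1 e.symm, h.1⟩
  · rintro ⟨j, k⟩ h
    rfl

variable (S N d) in
/-- The homological degree `p` part `N ⊗ Λ^p`: functions supported on the `p`-element sets. -/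
def koszulPiece (p : ℕ) : Submodule S (Finset (Fin d) → N) where
  carrier := {f | ∀ T : Finset (Fin d), T.card ≠ p → f T = 0}
  zero_mem' _ _ := rfl
  add_mem' hf hg T hT := by simp [hf T hT, hg T hT]
  smul_mem' c f hf T hT := by simp [hf T hT]

theorem koszulDiff_mem (φ : Fin d → Module.End S N) (p : ℕ) {f : Finset (Fin d) → N}
    (hf : f ∈ koszulPiece d S N (p + 1)) : koszulDiff φ f ∈ koszulPiece d S N p := by
  intro T hT
  rw [koszulDiff_apply]
  refine Finset.sum_eq_zero fun j hj => ?_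
  rw [hf, map_zero, smul_zero]
  rw [Finset.card_insert_of_notMem (Finset.mem_compl.1 hj)]
  omega

/-- The Koszul complex `K_•(φ; N)` of left `S`-modules. -/
def koszulComplex (φ : Fin d → Module.End S N) (hφ : ∀ i j, Commute (φ i) (φ j)) :
    ChainComplex (ModuleCat.{0} S) ℕ :=
  ChainComplex.of (fun p => ModuleCat.of S (koszulPiece d S N p))
    (fun p => ModuleCat.ofHom ((koszulDiff φ).restrict fun _ hf => koszulDiff_mem φ p hf))
    (fun p => by
      ext f T
      exact congrFun (koszulDiff_koszulDiff φ hφ f.1) T)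

theorem koszul_compLeft_mem (g : N →ₗ[S] N') (p : ℕ) {f : Finset (Fin d) → N}
    (hf : f ∈ koszulPiece d S N p) : g.compLeft (Finset (Fin d)) f ∈ koszulPiece d S N' p := by
  intro T hT
  simp [hf T hT]

/-- The map of Koszul complexes induced by an `S`-linear map that commutes with the given
endomorphisms. -/
def koszulMap (φ : Fin d → Module.End S N) (hφ : ∀ i j, Commute (φ i) (φ j))
    (φ' : Fin d → Module.End S N') (hφ' : ∀ i j, Commute (φ' i) (φ' j))
    (g : N →ₗ[S] N') (hg : ∀ i m, g (φ i m) = φ' i (g m)) :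
    koszulComplex φ hφ ⟶ koszulComplex φ' hφ' :=
  ChainComplex.ofHom
    (X := koszulComplex φ hφ) (Y := koszulComplex φ' hφ')
    (fun p => ModuleCat.ofHom ((g.compLeft (Finset (Fin d))).restrict
      fun _ hf => koszul_compLeft_mem g p hf))
    (fun p => by
      simp only [koszulComplex, ChainComplex.of_d]
      ext f T
      change koszulDiff φ' (g.compLeft (Finset (Fin d)) f.1) T = g (koszulDiff φ f.1 T)
      simp [koszulDiff_apply, hg])

end Koszul

/-! ### Euler-Koszul homology -/

section EulerKoszulHomology

set_option linter.unusedSectionVars false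

open CategoryTheory

variable {A : Matrix (Fin d) (Fin n) ℤ}
  {V : Type} [AddCommGroup V] [Module ℂ V] [Module (R n) V] [IsScalarTower ℂ (R n) V]
  {W : Type} [AddCommGroup W] [Module ℂ W] [Module (R n) W] [IsScalarTower ℂ (R n) W]

/-- The Euler-Koszul complex `𝒦_•(E - β; V)` of an `A`-graded `R`-module `V`. -/
def eulerKoszulComplex (β : Fin d → ℂ) (G : AGrading A V) :
    ChainComplex (ModuleCat.{0} (Weyl n)) ℕ :=
  koszulComplex (eulerEnd β G) (eulerEnd_comm β G)

/-- The Euler-Koszul homology `ℋᵢ(E - β, V)`, a left `D`-module. -/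
def eulerKoszulHomology (β : Fin d → ℂ) (G : AGrading A V) (i : ℕ) : ModuleCat.{0} (Weyl n) :=
  (eulerKoszulComplex β G).homology i

/-- The `D`-linear map `id ⊗ f : D ⊗_R V → D ⊗_R W`. -/
def weylTensorMap (f : V →ₗ[R n] W) : Weyl n ⊗[R n] V →ₗ[Weyl n] Weyl n ⊗[R n] W where
  toFun := f.lTensor (Weyl n)
  map_add' := map_add _
  map_smul' b t := by
    induction t using TensorProduct.induction_on with
    | zero => simp
    | tmul a v => simp [TensorProduct.smul_tmul']
    | add s t hs ht =>
      simp only [RingHom.id_apply] at hs ht ⊢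
      simp only [smul_add, map_add, hs, ht]

theorem weylTensorMap_tmul (f : V →ₗ[R n] W) (a : Weyl n) (v : V) :
    weylTensorMap f (a ⊗ₜ[R n] v) = a ⊗ₜ[R n] f v := rfl

/-- An `R`-linear map is homogeneous of degree `0`. -/
def IsGradedHom (G : AGrading A V) (H : AGrading A W) (f : V →ₗ[R n] W) : Prop :=
  ∀ α, ∀ v ∈ G.piece α, f v ∈ H.piece α

theorem IsGradedHom.degMap {G : AGrading A V} {H : AGrading A W} {f : V →ₗ[R n] W}
    (hf : IsGradedHom G H f) (i : Fin d) (v : V) : f (G.degMap i v) = H.degMap i (f v) := by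
  refine G.induction_on (fun v => f (G.degMap i v) = H.degMap i (f v)) v ?_ ?_ ?_
  · simp
  · intro u w hu hw
    simp only [map_add, hu, hw]
  · intro α u hu
    rw [G.degMap_of_mem i hu, H.degMap_of_mem i (hf α u hu)]
    exact (f.restrictScalars ℂ).map_smul _ _

theorem weylTensorMap_eulerEnd (β : Fin d → ℂ) {G : AGrading A V} {H : AGrading A W}
    {f : V →ₗ[R n] W} (hf : IsGradedHom G H f) (i : Fin d) (t : Weyl n ⊗[R n] V) :
    weylTensorMap f (eulerEnd β G i t) = eulerEnd β H i (weylTensorMap f t) := by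
  induction t using TensorProduct.induction_on with
  | zero => simp
  | tmul a v => simp only [eulerEnd_tmul, map_sub, weylTensorMap_tmul, hf.degMap]
  | add s t hs ht => simp only [map_add, hs, ht]

/-- The chain map `𝒦_•(E - β; V) → 𝒦_•(E - β; W)` induced by a graded homomorphism. -/
def eulerKoszulMap (β : Fin d → ℂ) {G : AGrading A V} {H : AGrading A W}
    {f : V →ₗ[R n] W} (hf : IsGradedHom G H f) :
    eulerKoszulComplex β G ⟶ eulerKoszulComplex β H :=
  koszulMap _ _ _ _ (weylTensorMap f) (weylTensorMap_eulerEnd β hf)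

/-- The `D`-linear map `ℋᵢ(E - β, V) → ℋᵢ(E - β, W)` induced by a graded homomorphism. -/
def eulerKoszulHomologyMap (β : Fin d → ℂ) {G : AGrading A V} {H : AGrading A W}
    {f : V →ₗ[R n] W} (hf : IsGradedHom G H f) (i : ℕ) :
    eulerKoszulHomology β G i ⟶ eulerKoszulHomology β H i :=
  HomologicalComplex.homologyMap (eulerKoszulMap β hf) i

end EulerKoszulHomology

/-! ### `A`-graded ideals and their quotients -/

section Ideals

/-- The `A`-grading of `R`: `deg ∂ⱼ = -aⱼ`. -/
abbrev polyPiece (A : Matrix (Fin d) (Fin n) ℤ) : (Fin d → ℤ) → Submodule ℂ (R n) :=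
  weightedHomogeneousSubmodule ℂ fun j => -A.col j

instance polyGradedAlgebra (A : Matrix (Fin d) (Fin n) ℤ) : GradedAlgebra (polyPiece A) :=
  weightedGradedAlgebra ℂ _

/-- `I` is an `A`-graded ideal. -/
def IsAGraded (A : Matrix (Fin d) (Fin n) ℤ) (I : Ideal (R n)) : Prop :=
  Ideal.IsHomogeneous (polyPiece A) I

/-- `I` is generated by binomials, i.e. polynomials with at most two terms. -/
def IsBinomial (I : Ideal (R n)) : Prop :=
  ∃ S : Set (R n), (∀ f ∈ S, f.support.card ≤ 2) ∧ I = Ideal.span S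

variable {A : Matrix (Fin d) (Fin n) ℤ} {I J : Ideal (R n)}

/-- The degree `α` part of `R/I`: the image of that of `R`. -/
def quotPiece (A : Matrix (Fin d) (Fin n) ℤ) (I : Ideal (R n)) (α : Fin d → ℤ) :
    Submodule ℂ (R n ⧸ I) :=
  (polyPiece A α).map (Ideal.Quotient.mkₐ ℂ I).toLinearMap

theorem quotPiece_isInternal (hI : IsAGraded A I) : DirectSum.IsInternal (quotPiece A I) := by
  classical
  constructor
  · rw [injective_iff_map_eq_zero]
    intro m hm
    have hex : ∀ α, ∃ g ∈ polyPiece A α, Ideal.Quotient.mk I g = (m α : R n ⧸ I) := fun α =>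
      (m α).2
    choose g hg hgm using hex
    rw [DirectSum.coeAddMonoidHom_eq_dfinsuppSum, DFinsupp.sum] at hm
    have hmem : ∑ α ∈ m.support, g α ∈ I := by
      rw [← Ideal.Quotient.eq_zero_iff_mem, map_sum, ← hm]
      exact Finset.sum_congr rfl fun α _ => hgm α
    by_contra hne
    obtain ⟨α, hα⟩ : ∃ α, α ∈ m.support := by
      by_contra! h
      exact hne (DFinsupp.support_eq_empty.1 (Finset.eq_empty_of_forall_notMem h))
    have h1 := hI α hmem
    rw [DirectSum.decompose_sum, DFinsupp.finsetSum_apply, AddSubmonoidClass.coe_finsetSum,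
      Finset.sum_eq_single α, DirectSum.decompose_of_mem_same _ (hg α)] at h1
    · rw [← Ideal.Quotient.eq_zero_iff_mem, hgm] at h1
      exact (DFinsupp.mem_support_iff.1 hα) (Subtype.ext h1)
    · intro γ _ hγ
      exact DirectSum.decompose_of_mem_ne _ (hg γ) hγ
    · intro h; exact absurd hα h
  · have h : (⨆ α, quotPiece A I α) = ⊤ := by
      have h2 := (DirectSum.Decomposition.isInternal (polyPiece A)).submodule_iSup_eq_top
      simp only [quotPiece]
      rw [← Submodule.map_iSup, h2, Submodule.map_top, LinearMap.range_eq_top]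
      exact Ideal.Quotient.mk_surjective
    have h3 := Submodule.iSup_eq_range_dfinsupp_lsum (quotPiece A I)
    rw [h] at h3
    exact LinearMap.range_eq_top.1 h3.symm

/-- The `A`-graded module `R/I` for an `A`-graded ideal `I`. -/
def quotGrading (hI : IsAGraded A I) : AGrading A (R n ⧸ I) where
  piece := quotPiece A I
  isInternal := quotPiece_isInternal hI
  X_smul_mem := by
    rintro j α _ ⟨f, hf, rfl⟩
    refine ⟨X j * f, ?_, rfl⟩
    have h : (X j : R n) ∈ polyPiece A (-A.col j) := isWeightedHomogeneous_X ℂ _ j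
    have h2 := SetLike.mul_mem_graded h hf
    rwa [neg_add_eq_sub] at h2

/-- The natural surjection `R/I → R/J` for `I ⊆ J`. -/
abbrev quotMap (h : I ≤ J) : (R n ⧸ I) →ₗ[R n] (R n ⧸ J) := Submodule.factor h

theorem quotMap_isGradedHom (hI : IsAGraded A I) (hJ : IsAGraded A J) (h : I ≤ J) :
    IsGradedHom (quotGrading hI) (quotGrading hJ) (quotMap h) := by
  rintro α _ ⟨f, hf, rfl⟩
  exact ⟨f, hf, rfl⟩

/-- The left ideal `H_A(I, β) = D I + D (E₁ - β₁, …, E_d - β_d)` of `D`. -/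
def hypergeometricIdeal (A : Matrix (Fin d) (Fin n) ℤ) (I : Ideal (R n)) (β : Fin d → ℂ) :
    Submodule (Weyl n) (Weyl n) :=
  Submodule.span (Weyl n) (Weyl.ofPoly '' (I : Set (R n)) ∪ Set.range (eulerSub A β))

/-- The binomial `D`-module `M_A(I, β) = D / H_A(I, β)`. -/
abbrev binomialDModule (A : Matrix (Fin d) (Fin n) ℤ) (I : Ideal (R n)) (β : Fin d → ℂ) : Type :=
  Weyl n ⧸ hypergeometricIdeal A I β

end Ideals

/-! ### Binomial primary decompositions and the Andean arrangement -/

section Primary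

/-- A partial character: a sublattice `Λ ⊆ ℤⁿ` with a homomorphism `ρ : Λ → ℂ*`. -/
structure PartialCharacter (n : ℕ) where
  lattice : AddSubgroup (Fin n → ℤ)
  char : Multiplicative lattice →* ℂˣ

/-- The exponent vector `u₊`; note that `u₋ = (-u)₊`. -/
def exponentPos (u : Fin n → ℤ) : Fin n →₀ ℕ := Finsupp.equivFunOnFinite.symm fun j => (u j).toNat

/-- The ideal `I_ρ` generated by the `∂^{u₊} - ρ(u) ∂^{u₋}`, `u ∈ Λ`. -/
def PartialCharacter.latticeIdeal (ρ : PartialCharacter n) : Ideal (R n) :=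
  Ideal.span (Set.range fun u : ρ.lattice =>
    monomial (exponentPos u.1) (1 : ℂ)
      - monomial (exponentPos (-u.1)) ((ρ.char (Multiplicative.ofAdd u) : ℂˣ) : ℂ))

/-- The ideal `I_{ρ,J} = I_ρ + ⟨∂ⱼ : j ∉ J⟩`. -/
def binomialPrime (ρ : PartialCharacter n) (J : Finset (Fin n)) : Ideal (R n) :=
  ρ.latticeIdeal ⊔ Ideal.span ((fun j => (X j : R n)) '' {j | j ∉ J})

/-- The rank of the submatrix `A_J` of `A` with columns indexed by `J`. -/
def rankCols (A : Matrix (Fin d) (Fin n) ℤ) (J : Finset (Fin n)) : ℕ :=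
  ((A.map (Int.cast : ℤ → ℚ)).submatrix id (Subtype.val : {j // j ∈ J} → Fin n)).rank

/-- `I_{ρ,J}` is toral if `dim R/I_{ρ,J} = rank A_J`, and otherwise Andean. -/
def IsAndean (A : Matrix (Fin d) (Fin n) ℤ) (ρ : PartialCharacter n) (J : Finset (Fin n)) : Prop :=
  ringKrullDim (R n ⧸ binomialPrime ρ J) ≠ (rankCols A J : WithBot ℕ∞)

/-- An irredundant binomial primary decomposition `I = ⋂ C_{ρ,J}` into `A`-graded binomial
ideals `C_{ρ,J}`, one for each associated prime `I_{ρ,J}` of `I`, where `C_{ρ,J}` is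
`I_{ρ,J}`-primary. -/
structure BinomialPrimaryDecomposition (A : Matrix (Fin d) (Fin n) ℤ) (I : Ideal (R n))
    (κ : Type) where
  ρ : κ → PartialCharacter n
  J : κ → Finset (Fin n)
  C : κ → Ideal (R n)
  /-- the domain of the partial character is a sublattice of `ℤ^J` -/
  lattice_supp : ∀ k, ∀ u ∈ (ρ k).lattice, ∀ j ∉ J k, u j = 0
  /-- the domain of the partial character is saturated -/
  lattice_saturated : ∀ k, ∀ (m : ℤ) (u : Fin n → ℤ), m ≠ 0 → m • u ∈ (ρ k).lattice →
    u ∈ (ρ k).lattice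
  isPrimary : ∀ k, (C k).IsPrimary
  radical_eq : ∀ k, (C k).radical = binomialPrime (ρ k) (J k)
  isBinomial : ∀ k, IsBinomial (C k)
  isAGraded : ∀ k, IsAGraded A (C k)
  /-- distinct components belong to distinct primes -/
  injective : Function.Injective fun k => binomialPrime (ρ k) (J k)
  range_eq : (Set.range fun k => binomialPrime (ρ k) (J k)) = associatedPrimes (R n) (R n ⧸ I)
  iInf_eq : ⨅ k, C k = I

namespace BinomialPrimaryDecomposition

variable {A : Matrix (Fin d) (Fin n) ℤ} {I : Ideal (R n)} {κ : Type}

/-- The quasidegrees of `R/C_{ρ,J}`. -/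
def qdeg (𝒞 : BinomialPrimaryDecomposition A I κ) (k : κ) : Set (Fin d → ℂ) :=
  (quotGrading (𝒞.isAGraded k)).qdeg

/-- The Andean arrangement: the union of the `qdeg (R/C_{ρ,J})` over the Andean components. -/
def andeanArrangement (𝒞 : BinomialPrimaryDecomposition A I κ) : Set (Fin d → ℂ) :=
  ⋃ k ∈ {k | IsAndean A (𝒞.ρ k) (𝒞.J k)}, 𝒞.qdeg k

/-- The ideal `I_β`: the intersection of the components with `-β ∈ qdeg (R/C_{ρ,J})`. -/
def idealAt (𝒞 : BinomialPrimaryDecomposition A I κ) (β : Fin d → ℂ) : Ideal (R n) :=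
  ⨅ k ∈ {k | -β ∈ 𝒞.qdeg k}, 𝒞.C k

theorem idealAt_isAGraded (𝒞 : BinomialPrimaryDecomposition A I κ) (β : Fin d → ℂ) :
    IsAGraded A (𝒞.idealAt β) :=
  Ideal.IsHomogeneous.iInf₂ fun k _ => 𝒞.isAGraded k

theorem le_idealAt (𝒞 : BinomialPrimaryDecomposition A I κ) (β : Fin d → ℂ) :
    I ≤ 𝒞.idealAt β :=
  le_iInf₂ fun k _ => 𝒞.iInf_eq.symm.le.trans (iInf_le _ k)

end BinomialPrimaryDecomposition

end Primary

/-- The standing assumptions on `A`: its columns span `ℤᵈ` and are nonzero, and the real cone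
that they generate contains no line. -/
structure IsPointedSpanning (A : Matrix (Fin d) (Fin n) ℤ) : Prop where
  span_eq : AddSubgroup.closure (Set.range A.col) = ⊤
  col_ne_zero : ∀ j, A.col j ≠ 0
  salient : (PointedCone.hull ℝ
    (Set.range fun j => (fun i => (A i j : ℝ) : Fin d → ℝ)) : ConvexCone ℝ (Fin d → ℝ)).Salient

end
end EulerKoszul

open EulerKoszul CategoryTheory

/-!
Write `φ_k` for the endomorphism `E_k - β_k` of `D ⊗ R/I` in the Euler-Koszul complex, and `N` for
the image of `D ⊗ I_β` in `D ⊗ R/I`, which is the kernel of the surjection to `D ⊗ R/I_β`. The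
proof produces a polynomial in the `φ_k` with constant term `1` that annihilates `N`
(`exists_isUnitalPair_annihilates`). Neither the flatness of `D` over `R` nor a prime filtration is
needed.

**The polynomial.** Consider ideals `I ≤ L < I_β`. Choose a homogeneous `f` in `I_β` but not in
`L`, of degree `α`, such that as few of the `∂ⱼ f` as possible lie outside `L`, and let `J` be the
set of the `j` with `∂ⱼ f ∉ L`. By minimality no monomial in the `∂ⱼ`, `j ∈ J`, takes `f` into `L`,
so all degrees in `α - ℕ A_J` occur in `I_β / I`
(`exists_homogeneous_monomial_mul_notMem`). An element of `I_β` outside `I` is nonzero in some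
`R/C_{ρ,J}` whose quasidegrees do not contain `-β`; so some polynomial vanishes on these degrees
and not at `-β`. Since `α - ℕ A_J` is Zariski dense in `α - ℂ A_J`, the point `-β` is not in
`α - ℂ A_J`, and there is a linear functional `l` that vanishes on the `aⱼ`, `j ∈ J`, with
`c = l(α + β) ≠ 0` (`exists_linear_functional_of_eval_eq_zero`). Then `c + ∑ l_k φ_k` sends
`1 ⊗ f` to `∑_{j ∉ J} l(aⱼ) xⱼ ⊗ ∂ⱼ f`, which is in the image of `D ⊗ L`
(`sum_smul_eulerEnd_one_tmul`). So a polynomial for `L` times `1 + c⁻¹ ∑ l_k φ_k` is one for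
`L + ⟨f⟩`, and Noetherian induction reaches `I_β`.

**Homology.** Each `φ_k` is null-homotopic on the Koszul complex, so a polynomial `ψ` in the
`φ_k` with constant term `1` is homotopic to the identity (`homologyMap_koszulMap_eq_id`). If `ψ`
kills `N`, it factors through `D ⊗ R/I_β`, and the factor is a homotopy inverse of the
surjection (`IsUnitalPair.isIso_homologyMap`).

**The modules `M_A`.** If `ψ = 1 + ∑ φ_k q_k` kills `1 ⊗ f`, then `1 ⊗ f` is in the image of the
`φ_k`, which maps to zero in `M_A(I, β)`. So `M_A(I, β)` and `M_A(I_β, β)` are quotients of `D` by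
the same left ideal (`hypergeometricIdeal_eq_of_annihilates`).
-/

namespace EulerKoszul

/-! ### Endomorphisms homotopic to the identity on a Koszul complex -/

section KoszulHomotopy

variable {d : ℕ} {S : Type} [Ring S] {N N' : Type} [AddCommGroup N] [Module S N]
  [AddCommGroup N'] [Module S N']

/-- The operator `m ⊗ ω ↦ q(m) ⊗ (e_k ∧ ω)` on `N ⊗ Λ(ℤᵈ)`, with elements written as functions
on the subsets of `{1, …, d}` as in `koszulDiff`. -/
def koszulWedge (k : Fin d) (q : Module.End S N) :
    (Finset (Fin d) → N) →ₗ[S] (Finset (Fin d) → N) :=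
  LinearMap.pi fun T =>
    if k ∈ T then koszulSign k T • (q ∘ₗ LinearMap.proj (T.erase k)) else 0

theorem koszulWedge_apply_of_mem {k : Fin d} (q : Module.End S N) (f : Finset (Fin d) → N)
    {T : Finset (Fin d)} (h : k ∈ T) :
    koszulWedge k q f T = koszulSign k T • q (f (T.erase k)) := by
  simp [koszulWedge, h]

theorem koszulWedge_apply_of_notMem {k : Fin d} (q : Module.End S N) (f : Finset (Fin d) → N)
    {T : Finset (Fin d)} (h : k ∉ T) : koszulWedge k q f T = 0 := by
  simp [koszulWedge, h]

theorem koszulSign_mul_self (j : Fin d) (T : Finset (Fin d)) :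
    koszulSign j T * koszulSign j T = 1 := by
  rw [koszulSign, ← mul_pow]; simp

theorem koszulSign_erase_self (j : Fin d) (T : Finset (Fin d)) :
    koszulSign j (T.erase j) = koszulSign j T := by
  by_cases h : j ∈ T
  · conv_rhs => rw [← Finset.insert_erase h]
    rw [koszulSign_insert_of_not_lt (lt_irrefl j)]
  · rw [Finset.erase_eq_of_notMem h]

theorem koszulSign_anticomm {j k : Fin d} {T : Finset (Fin d)} (hk : k ∈ T) (hj : j ∉ T) :
    koszulSign j T * koszulSign k (insert j T)
      = -(koszulSign k T * koszulSign j (T.erase k)) := by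
  have hne : j ≠ k := fun h => hj (h ▸ hk)
  have hT : koszulSign j T = koszulSign j (insert k (T.erase k)) := by
    rw [Finset.insert_erase hk]
  rcases lt_or_gt_of_ne hne with h | h
  · rw [hT, koszulSign_insert_of_lt hj h, koszulSign_insert_of_not_lt h.le.not_gt]
    ring
  · rw [hT, koszulSign_insert_of_lt (Finset.notMem_erase k T) h,
      koszulSign_insert_of_not_lt h.le.not_gt]
    ring

/-- The homotopy formula: contraction with the `φⱼ` and exterior multiplication by `e_k`
anticommute up to `φ_k`. -/
theorem koszulDiff_koszulWedge_add (φ : Fin d → Module.End S N) (k : Fin d) (q : Module.End S N)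
    (hq : ∀ i, Commute q (φ i)) (f : Finset (Fin d) → N) (T : Finset (Fin d)) :
    koszulDiff φ (koszulWedge k q f) T + koszulWedge k q (koszulDiff φ f) T
      = φ k (q (f T)) := by
  by_cases hk : k ∈ T
  · rw [koszulWedge_apply_of_mem q _ hk, koszulDiff_apply, koszulDiff_apply]
    have hc : (T.erase k)ᶜ = insert k Tᶜ := by
      ext j; simp only [Finset.mem_compl, Finset.mem_erase, Finset.mem_insert]; tauto
    rw [hc, Finset.sum_insert (by simpa using hk), Finset.insert_erase hk, koszulSign_erase_self,
      map_add, map_zsmul, smul_add, smul_smul, koszulSign_mul_self, one_smul, add_left_comm,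
      map_sum, Finset.smul_sum, ← Finset.sum_add_distrib, Finset.sum_eq_zero, add_zero]
    · exact LinearMap.congr_fun (hq k) _
    · intro j hj
      have hj' : j ∉ T := Finset.mem_compl.1 hj
      have hjk : j ≠ k := fun h => hj' (h ▸ hk)
      have hcomm : φ j (q (f (insert j (T.erase k)))) = q (φ j (f (insert j (T.erase k)))) :=
        (LinearMap.congr_fun (hq j) _).symm
      rw [koszulWedge_apply_of_mem q f (Finset.mem_insert_of_mem hk), map_zsmul, map_zsmul,
        smul_smul, smul_smul, Finset.erase_insert_of_ne hjk, hcomm, ← add_smul,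
        koszulSign_anticomm hk hj', neg_add_cancel, zero_smul]
  · rw [koszulWedge_apply_of_notMem q _ hk, add_zero, koszulDiff_apply,
      Finset.sum_eq_single k]
    · rw [koszulWedge_apply_of_mem q f (Finset.mem_insert_self k T),
        koszulSign_insert_of_not_lt (lt_irrefl k), map_zsmul, smul_smul, koszulSign_mul_self,
        one_smul, Finset.erase_insert hk]
    · intro j _ hjk
      rw [koszulWedge_apply_of_notMem q f (by simp [hk, hjk.symm]), map_zero, smul_zero]
    · intro h; exact absurd (Finset.mem_compl.2 hk) h

theorem koszulWedge_mem (k : Fin d) (q : Module.End S N) {p p' : ℕ} (hp : p + 1 = p')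
    {f : Finset (Fin d) → N} (hf : f ∈ koszulPiece d S N p) :
    koszulWedge k q f ∈ koszulPiece d S N p' := by
  intro T hT
  by_cases hk : k ∈ T
  · rw [koszulWedge_apply_of_mem q f hk, hf, map_zero, smul_zero]
    rw [Finset.card_erase_of_mem hk]
    have := Finset.card_pos.2 ⟨k, hk⟩
    omega
  · exact koszulWedge_apply_of_notMem q f hk

/-- The homotopy `∑ₖ q_k ⊗ (e_k ∧ -)` in homological degree `p`. -/
def koszulHomotopy (q : Fin d → Module.End S N) {p p' : ℕ} (hp : p + 1 = p') :
    koszulPiece d S N p →ₗ[S] koszulPiece d S N p' :=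
  (∑ k, koszulWedge k (q k)).restrict fun f hf => by
    rw [LinearMap.sum_apply]
    exact Submodule.sum_mem _ fun k _ => koszulWedge_mem k (q k) hp hf

theorem koszulHomotopy_apply (q : Fin d → Module.End S N) {p p' : ℕ} (hp : p + 1 = p')
    (f : koszulPiece d S N p) :
    (koszulHomotopy q hp f).1 = ∑ k, koszulWedge k (q k) f.1 := by
  simp [koszulHomotopy, LinearMap.restrict_apply]

theorem koszulComplex_d (φ : Fin d → Module.End S N) (hφ : ∀ i j, Commute (φ i) (φ j)) (p : ℕ) :
    (koszulComplex φ hφ).d (p + 1) p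
      = ModuleCat.ofHom ((koszulDiff φ).restrict fun _ hf => koszulDiff_mem φ p hf) := by
  simp only [koszulComplex, ChainComplex.of_d]

theorem koszulDiff_eq_zero_of_mem_zero (φ : Fin d → Module.End S N) {f : Finset (Fin d) → N}
    (hf : f ∈ koszulPiece d S N 0) : koszulDiff φ f = 0 := by
  funext T
  rw [koszulDiff_apply]
  refine Finset.sum_eq_zero fun j _ => ?_
  rw [hf _ (by simp), map_zero, smul_zero]

/-- On Koszul homology the `φ_k` act as zero, so `1 + ∑ φ_k q_k` acts as the identity. -/
theorem homologyMap_koszulMap_eq_id (φ : Fin d → Module.End S N)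
    (hφ : ∀ i j, Commute (φ i) (φ j)) (q : Fin d → Module.End S N)
    (hq : ∀ k i, Commute (q k) (φ i)) (ψ : Module.End S N) (hψ : ψ = 1 + ∑ k, φ k * q k)
    (hψφ : ∀ i m, ψ (φ i m) = φ i (ψ m)) (i : ℕ) :
    HomologicalComplex.homologyMap (koszulMap φ hφ φ hφ ψ hψφ) i = 𝟙 _ := by
  let h : ∀ a b : ℕ, (ComplexShape.down ℕ).Rel b a →
      ((koszulComplex φ hφ).X a ⟶ (koszulComplex φ hφ).X b) :=
    fun a b hab => ModuleCat.ofHom (koszulHomotopy q hab)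
  have key : ∀ (f : Finset (Fin d) → N) (T : Finset (Fin d)), ψ (f T) = f T +
      (koszulDiff φ (∑ k, koszulWedge k (q k) f) T
        + ∑ k, koszulWedge k (q k) (koszulDiff φ f) T) := by
    intro f T
    rw [map_sum, Finset.sum_apply, ← Finset.sum_add_distrib,
      Finset.sum_congr rfl fun k _ => koszulDiff_koszulWedge_add φ k (q k) (hq k) f T, hψ]
    simp
  have hmap : koszulMap φ hφ φ hφ ψ hψφ = 𝟙 _ + Homotopy.nullHomotopicMap' h := by
    ext p f
    cases p with
    | zero =>
      rw [HomologicalComplex.add_f_apply, Homotopy.nullHomotopicMap'_f_of_not_rel_left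
        (k₁ := 1) (k₀ := 0) (by simp) (by simp)]
      rw [koszulComplex_d]
      refine Subtype.ext (funext fun T => (key f.1 T).trans ?_)
      rw [koszulDiff_eq_zero_of_mem_zero φ f.2]
      simp only [map_zero, Finset.sum_const_zero, Pi.zero_apply, add_zero,
        ← koszulHomotopy_apply q (zero_add 1) f]
      rfl
    | succ p =>
      rw [HomologicalComplex.add_f_apply, Homotopy.nullHomotopicMap'_f
        (k₂ := p + 2) (k₁ := p + 1) (k₀ := p) (by simp) (by simp)]
      rw [koszulComplex_d, koszulComplex_d]
      refine Subtype.ext (funext fun T => (key f.1 T).trans ?_)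
      rw [← koszulHomotopy_apply q rfl f, add_comm (koszulDiff φ _ T),
        ← Finset.sum_apply,
        ← koszulHomotopy_apply q rfl (⟨koszulDiff φ f.1, koszulDiff_mem φ p f.2⟩ :
          koszulPiece d S N p)]
      rfl
  rw [hmap, HomologicalComplex.homologyMap_add, HomologicalComplex.homologyMap_id,
    (Homotopy.nullHomotopy' h).homologyMap_eq, HomologicalComplex.homologyMap_zero, add_zero]

/-- `ψ = 1 + ∑ φ_k q_k` and `ψ' = 1 + ∑ φ'_k q'_k`, where the `q_k` commute with the `φ_i`, the
`q'_k` with the `φ'_i`, and `q_k` corresponds to `q'_k` under `g`. The case to keep in mind is a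
polynomial with constant term `1`, evaluated at the commuting endomorphisms `φ` and at `φ'`;
this form avoids evaluating polynomials in a noncommutative endomorphism ring. -/
def IsUnitalPair (φ : Fin d → Module.End S N) (φ' : Fin d → Module.End S N') (g : N →ₗ[S] N')
    (ψ : Module.End S N) (ψ' : Module.End S N') : Prop :=
  ∃ (q : Fin d → Module.End S N) (q' : Fin d → Module.End S N'),
    (∀ k i, Commute (q k) (φ i)) ∧ (∀ k i, Commute (q' k) (φ' i)) ∧
    (∀ k m, g (q k m) = q' k (g m)) ∧
    ψ = 1 + ∑ k, φ k * q k ∧ ψ' = 1 + ∑ k, φ' k * q' k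

variable {φ : Fin d → Module.End S N} {φ' : Fin d → Module.End S N'} {g : N →ₗ[S] N'}

theorem IsUnitalPair.one : IsUnitalPair φ φ' g 1 1 :=
  ⟨0, 0, fun _ _ => Commute.zero_left _, fun _ _ => Commute.zero_left _, by simp, by simp,
    by simp⟩

theorem commute_one_add_sum (hφ : ∀ i j, Commute (φ i) (φ j)) {q : Fin d → Module.End S N}
    (hq : ∀ k i, Commute (q k) (φ i)) (i : Fin d) : Commute (1 + ∑ k, φ k * q k) (φ i) :=
  (Commute.one_left _).add_left
    (Commute.sum_left _ _ _ fun k _ => (hφ k i).mul_left (hq k i))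

theorem map_one_add_sum (hg : ∀ i m, g (φ i m) = φ' i (g m)) {q : Fin d → Module.End S N}
    {q' : Fin d → Module.End S N'} (hq : ∀ k m, g (q k m) = q' k (g m)) (m : N) :
    g ((1 + ∑ k, φ k * q k : Module.End S N) m)
      = (1 + ∑ k, φ' k * q' k : Module.End S N') (g m) := by
  simp [hg, hq]

theorem IsUnitalPair.mul (hφ : ∀ i j, Commute (φ i) (φ j)) (hφ' : ∀ i j, Commute (φ' i) (φ' j))
    (hg : ∀ i m, g (φ i m) = φ' i (g m)) {ψ χ : Module.End S N} {ψ' χ' : Module.End S N'}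
    (h : IsUnitalPair φ φ' g ψ ψ') (k : IsUnitalPair φ φ' g χ χ') :
    IsUnitalPair φ φ' g (ψ * χ) (ψ' * χ') := by
  obtain ⟨q, q', hq, hq', hgq, rfl, rfl⟩ := h
  obtain ⟨r, r', hr, hr', hgr, rfl, rfl⟩ := k
  refine ⟨fun k => r k + q k * (1 + ∑ k, φ k * r k), fun k => r' k + q' k * (1 + ∑ k, φ' k * r' k),
    fun k i => (hr k i).add_left ((hq k i).mul_left (commute_one_add_sum hφ hr i)),
    fun k i => (hr' k i).add_left ((hq' k i).mul_left (commute_one_add_sum hφ' hr' i)),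
    fun k m => ?_, ?_, ?_⟩
  · rw [LinearMap.add_apply, map_add, hgr, Module.End.mul_apply, hgq, map_one_add_sum hg hgr]
    rfl
  · simp only [mul_add, Finset.sum_add_distrib, add_mul, one_mul, mul_one, Finset.sum_mul,
      mul_assoc]
    abel
  · simp only [mul_add, Finset.sum_add_distrib, add_mul, one_mul, mul_one, Finset.sum_mul,
      mul_assoc]
    abel

/-- If `ψ` belongs to a unital pair and kills the kernel of the surjection `g`, then it
factors as `s ∘ g`, and `s` is a homotopy inverse of `g` on Koszul complexes. -/
theorem IsUnitalPair.isIso_homologyMap {ψ : Module.End S N} {ψ' : Module.End S N'}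
    (h : IsUnitalPair φ φ' g ψ ψ')
    (hφ : ∀ i j, Commute (φ i) (φ j)) (hφ' : ∀ i j, Commute (φ' i) (φ' j))
    (hg : ∀ i m, g (φ i m) = φ' i (g m)) (hsurj : Function.Surjective g)
    (hker : ∀ m, g m = 0 → ψ m = 0) (i : ℕ) :
    IsIso (HomologicalComplex.homologyMap (koszulMap φ hφ φ' hφ' g hg) i) := by
  obtain ⟨q, q', hq, hq', hgq, hψ, hψ'⟩ := h
  let s : N' →ₗ[S] N := (LinearMap.ker g).liftQ ψ hker ∘ₗ
    (g.quotKerEquivOfSurjective hsurj).symm.toLinearMap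
  have hs : ∀ m, s (g m) = ψ m := fun m => by
    have : (g.quotKerEquivOfSurjective hsurj).symm (g m) = Submodule.Quotient.mk m := by
      rw [LinearEquiv.symm_apply_eq]; rfl
    rw [LinearMap.comp_apply, LinearEquiv.coe_coe, this]
    rfl
  have hgψ : ∀ m, g (ψ m) = ψ' (g m) := fun m => by
    rw [hψ, hψ']; exact map_one_add_sum hg hgq m
  have hgs : ∀ m, g (s m) = ψ' m := fun m => by
    obtain ⟨m, rfl⟩ := hsurj m
    rw [hs, hgψ]
  have hψφ : ∀ i m, ψ (φ i m) = φ i (ψ m) := fun i m => by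
    rw [hψ]; exact LinearMap.congr_fun (commute_one_add_sum hφ hq i) m
  have hψφ' : ∀ i m, ψ' (φ' i m) = φ' i (ψ' m) := fun i m => by
    rw [hψ']; exact LinearMap.congr_fun (commute_one_add_sum hφ' hq' i) m
  have hsφ : ∀ i m, s (φ' i m) = φ i (s m) := fun i m => by
    obtain ⟨m, rfl⟩ := hsurj m
    rw [← hg, hs, hs, hψφ]
  refine ⟨HomologicalComplex.homologyMap (koszulMap φ' hφ' φ hφ s hsφ) i, ?_, ?_⟩
  · rw [← HomologicalComplex.homologyMap_comp,
      ← homologyMap_koszulMap_eq_id φ hφ q hq ψ hψ hψφ i]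
    congr 1
    ext p f
    exact Subtype.ext (funext fun T => hs _)
  · rw [← HomologicalComplex.homologyMap_comp,
      ← homologyMap_koszulMap_eq_id φ' hφ' q' hq' ψ' hψ' hψφ' i]
    congr 1
    ext p f
    exact Subtype.ext (funext fun T => hgs _)

end KoszulHomotopy

variable {d n : ℕ} {A : Matrix (Fin d) (Fin n) ℤ}

/-! ### Quasidegrees and linear functionals -/

/-- A point outside the Zariski closure of a set is separated from it by a polynomial. -/
theorem exists_eval_ne_zero_of_notMem_zariskiClosure {S : Set (Fin d → ℂ)} {x : Fin d → ℂ}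
    (hx : x ∉ zariskiClosure S) :
    ∃ g : MvPolynomial (Fin d) ℂ, (∀ y ∈ S, eval y g = 0) ∧ eval x g ≠ 0 := by
  by_contra! h
  refine hx fun g hg => ?_
  have := h g fun y hy => by simpa [aeval_eq_eval] using mem_vanishingIdeal_iff.1 hg y hy
  simpa [aeval_eq_eval] using this

/-- The set `α - ℕ A_J` is Zariski dense in the affine space `α - ℂ A_J`. So if a polynomial
vanishes on the former and not at `-β`, then some linear functional vanishes on the columns in `J`
but not at `α + β`. -/
theorem exists_linear_functional_of_eval_eq_zero (A : Matrix (Fin d) (Fin n) ℤ) (β : Fin d → ℂ)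
    (α : Fin d → ℤ) (J : Set (Fin n)) (g : MvPolynomial (Fin d) ℂ)
    (hg : ∀ u : Fin n →₀ ℕ, (∀ j ∉ J, u j = 0) →
      eval (toComplex (α - A.mulVec fun j => (u j : ℤ))) g = 0)
    (hβ : eval (-β) g ≠ 0) :
    ∃ l : Fin d → ℂ, (∀ j ∈ J, ∑ i, l i * (A i j : ℂ) = 0) ∧
      ∑ i, l i * (β i + (α i : ℂ)) ≠ 0 := by
  classical
  let B : Matrix (Fin d) (Fin n) ℂ := fun i j => if j ∈ J then (A i j : ℂ) else 0
  have hnot : (fun i => β i + (α i : ℂ)) ∉ LinearMap.range B.mulVecLin := by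
    rintro ⟨z, hz⟩
    let h : MvPolynomial (Fin n) ℂ := bind₁ (fun i => C (α i : ℂ) - ∑ j, C (B i j) * X j) g
    have heval : ∀ x : Fin n → ℂ,
        eval x h = eval (fun i => (α i : ℂ) - B.mulVec x i) g := by
      intro x
      rw [← aeval_eq_eval, ← aeval_eq_eval]
      simp only [h, aeval_bind₁]
      congr 2
      funext i
      simp [Matrix.mulVec, dotProduct]
    have hzero : h = 0 := by
      refine funext_set (fun _ => Set.range (Nat.cast : ℕ → ℂ)) (fun _ =>
        Set.infinite_range_of_injective Nat.cast_injective) fun x hx => ?_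
      choose v hv using fun j => hx j trivial
      rw [heval, map_zero, ← hg (Finsupp.equivFunOnFinite.symm fun j => if j ∈ J then v j else 0)
        (fun j hj => by simp [hj])]
      congr 2
      funext i
      simp only [toComplex, Pi.sub_apply, Matrix.mulVec, dotProduct, B, ← hv]
      push_cast
      congr 1
      refine Finset.sum_congr rfl fun j _ => ?_
      by_cases hj : j ∈ J <;> simp [hj]
    apply hβ
    have h1 := heval z
    rw [hzero, map_zero] at h1
    rw [h1]
    congr 2
    funext i
    have h2 := congrFun hz i
    simp only [Matrix.mulVecLin_apply] at h2
    rw [h2]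
    simp
  obtain ⟨f, hf, hle⟩ := Submodule.exists_le_ker_of_notMem hnot
  have hsum : ∀ v : Fin d → ℂ, f v = ∑ i, f (Pi.single i 1) * v i := by
    intro v
    rw [LinearMap.pi_apply_eq_sum_univ f v]
    refine Finset.sum_congr rfl fun i _ => ?_
    rw [smul_eq_mul, mul_comm]
    congr 2
    funext k
    simp [Pi.single_apply, eq_comm]
  refine ⟨fun i => f (Pi.single i 1), fun j hj => ?_, ?_⟩
  · have h1 : f (B.mulVec (Pi.single j 1)) = 0 := hle ⟨Pi.single j 1, rfl⟩
    rw [hsum] at h1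
    rw [Matrix.mulVec_single_one] at h1
    change ∑ i, f (Pi.single i 1) * (if j ∈ J then (A i j : ℂ) else 0) = 0 at h1
    simpa only [if_pos hj] using h1
  · rwa [hsum] at hf

theorem mem_tdeg_quotGrading {C : Ideal (R n)} (hC : IsAGraded A C) {γ : Fin d → ℤ} {f : R n}
    (hf : f ∈ polyPiece A γ) (hfC : f ∉ C) : γ ∈ (quotGrading hC).tdeg := by
  intro h
  have h1 : Ideal.Quotient.mk C f ∈ (quotGrading hC).piece γ := ⟨f, hf, rfl⟩
  rw [h, Submodule.mem_bot, Ideal.Quotient.eq_zero_iff_mem] at h1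
  exact hfC h1

theorem monomial_mul_mem_polyPiece {α : Fin d → ℤ} {f : R n} (hf : f ∈ polyPiece A α)
    (u : Fin n →₀ ℕ) :
    monomial u (1 : ℂ) * f ∈ polyPiece A (α - A.mulVec fun j => (u j : ℤ)) := by
  have h : monomial u (1 : ℂ) ∈ polyPiece A (-(A.mulVec fun j => (u j : ℤ))) := by
    refine isWeightedHomogeneous_monomial _ _ _ ?_
    funext i
    rw [Finsupp.weight_apply, Finsupp.sum_fintype _ _ (by simp)]
    simp [Matrix.mulVec, dotProduct, mul_comm]
  have h2 := SetLike.mul_mem_graded h hf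
  rwa [neg_add_eq_sub] at h2

theorem exists_homogeneous_mem_notMem {K L : Ideal (R n)} (hK : IsAGraded A K) (h : ¬ K ≤ L) :
    ∃ f ∈ K, f ∉ L ∧ ∃ α, f ∈ polyPiece A α := by
  by_contra! h1
  refine h fun f hf => ?_
  rw [← DirectSum.sum_support_decompose (polyPiece A) f]
  refine Ideal.sum_mem _ fun α _ => ?_
  by_contra h2
  exact h1 _ (hK α hf) h2 α (SetLike.coe_mem _)

/-- In place of an associated prime: if `K` is not contained in `L`, there is a homogeneous `f` in
`K` outside `L` such that no monomial in the variables `∂ⱼ` with `∂ⱼ f ∉ L` takes `f` into `L`. It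
is found by minimising the number of these variables. -/
theorem exists_homogeneous_monomial_mul_notMem {K L : Ideal (R n)} (hK : IsAGraded A K)
    (h : ¬ K ≤ L) :
    ∃ f ∈ K, f ∉ L ∧ (∃ α, f ∈ polyPiece A α) ∧
      ∀ u : Fin n →₀ ℕ, (∀ j, X j * f ∈ L → u j = 0) → monomial u (1 : ℂ) * f ∉ L := by
  classical
  let J : R n → Finset (Fin n) := fun f => Finset.univ.filter fun j => X j * f ∉ L
  obtain ⟨f, ⟨hfK, hfL, α, hfα⟩, hmin⟩ := WellFounded.has_min
    (InvImage.wf (fun f => (J f).card) wellFounded_lt)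
    {f | f ∈ K ∧ f ∉ L ∧ ∃ α, f ∈ polyPiece A α} (by
      obtain ⟨f, h1, h2, h3⟩ := exists_homogeneous_mem_notMem hK h
      exact ⟨f, h1, h2, h3⟩)
  refine ⟨f, hfK, hfL, ⟨α, hfα⟩, fun u => ?_⟩
  induction hN : u.degree generalizing u with
  | zero =>
    intro _
    rw [(Finsupp.degree_eq_zero_iff u).1 hN]
    simpa using hfL
  | succ N ih =>
    intro hu hmem
    obtain ⟨j, hj⟩ : ∃ j, u j ≠ 0 := by
      by_contra! h0
      rw [show u = 0 from Finsupp.ext h0] at hN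
      simp at hN
    have hle : Finsupp.single j 1 ≤ u := by
      rw [Finsupp.single_le_iff]; omega
    obtain ⟨v, rfl⟩ := exists_add_of_le hle
    have hv : v.degree = N := by
      rw [map_add, Finsupp.degree_single] at hN; omega
    have hmon : monomial (Finsupp.single j 1 + v) (1 : ℂ) * f
        = X j * (monomial v (1 : ℂ) * f) := by
      rw [← mul_assoc, X, monomial_mul, one_mul]
    have hvL := ih v hv fun k hk => by
      have := hu k hk
      simp only [Finsupp.add_apply] at this
      omega
    have hjf : X j * f ∉ L := fun hk => hj (hu j hk)
    refine hmin (monomial v 1 * f)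
      ⟨K.mul_mem_left _ hfK, hvL, _, monomial_mul_mem_polyPiece hfα v⟩ ?_
    refine Finset.card_lt_card ⟨fun k hk => ?_, fun hsub => ?_⟩
    · simp only [J, Finset.mem_filter, Finset.mem_univ, true_and] at hk ⊢
      refine fun hk' => hk ?_
      rw [mul_left_comm]
      exact L.mul_mem_left _ hk'
    · have h1 : j ∈ J (monomial v 1 * f) :=
        hsub (by simp only [J, Finset.mem_filter, Finset.mem_univ, true_and]; exact hjf)
      simp only [J, Finset.mem_filter, Finset.mem_univ, true_and] at h1
      exact h1 (hmon ▸ hmem)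

namespace BinomialPrimaryDecomposition

variable {I : Ideal (R n)} {κ : Type}

theorem exists_eval_eq_zero_on_tdeg [Finite κ] (𝒞 : BinomialPrimaryDecomposition A I κ)
    (β : Fin d → ℂ) :
    ∃ g : MvPolynomial (Fin d) ℂ, eval (-β) g ≠ 0 ∧
      ∀ k, -β ∉ 𝒞.qdeg k → ∀ γ ∈ (quotGrading (𝒞.isAGraded k)).tdeg,
        eval (toComplex γ) g = 0 := by
  have := Fintype.ofFinite κ
  have h : ∀ k, ∃ g : MvPolynomial (Fin d) ℂ, eval (-β) g ≠ 0 ∧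
      (-β ∉ 𝒞.qdeg k → ∀ γ ∈ (quotGrading (𝒞.isAGraded k)).tdeg,
        eval (toComplex γ) g = 0) := by
    intro k
    by_cases hk : -β ∈ 𝒞.qdeg k
    · exact ⟨1, by simp, fun h => absurd hk h⟩
    · obtain ⟨g, h1, h2⟩ := exists_eval_ne_zero_of_notMem_zariskiClosure hk
      exact ⟨g, h2, fun _ γ hγ => h1 _ ⟨γ, hγ, rfl⟩⟩
  choose g h1 h2 using h
  refine ⟨∏ k, g k, ?_, fun k hk γ hγ => ?_⟩
  · rw [map_prod]
    exact Finset.prod_ne_zero_iff.2 fun k _ => h1 k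
  · rw [map_prod]
    exact Finset.prod_eq_zero (Finset.mem_univ k) (h2 k hk γ hγ)

theorem exists_notMem_of_mem_idealAt (𝒞 : BinomialPrimaryDecomposition A I κ) (β : Fin d → ℂ)
    {f : R n} (hf : f ∈ 𝒞.idealAt β) (hfI : f ∉ I) : ∃ k, -β ∉ 𝒞.qdeg k ∧ f ∉ 𝒞.C k := by
  by_contra! h
  refine hfI ?_
  rw [← 𝒞.iInf_eq, Ideal.mem_iInf]
  intro k
  by_cases hk : -β ∈ 𝒞.qdeg k
  · exact (iInf₂_le k hk : 𝒞.idealAt β ≤ 𝒞.C k) hf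
  · exact h k hk

end BinomialPrimaryDecomposition

/-! ### Polynomials in the Euler operators that annihilate the kernel -/

section Annihilation

variable {I K : Ideal (R n)} (β : Fin d → ℂ)

/-- On `1 ⊗ f` with `f` homogeneous of degree `α`, a linear combination `∑ lᵢ (Eᵢ - βᵢ)` acts as
the scalar `-∑ lᵢ (βᵢ + αᵢ)`, up to the terms `l(aⱼ) xⱼ ⊗ ∂ⱼ f`. -/
theorem sum_smul_eulerEnd_one_tmul (hI : IsAGraded A I) (l : Fin d → ℂ) {α : Fin d → ℤ} {f : R n}
    (hf : f ∈ polyPiece A α) :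
    (∑ i, l i • eulerEnd β (quotGrading hI) i) ((1 : Weyl n) ⊗ₜ[R n] Ideal.Quotient.mk I f)
      = ∑ j, (∑ i, l i * (A i j : ℂ)) • (Weyl.x j ⊗ₜ[R n] Ideal.Quotient.mk I (X j * f))
        - (∑ i, l i * (β i + (α i : ℂ))) • ((1 : Weyl n) ⊗ₜ[R n] Ideal.Quotient.mk I f) := by
  have hdeg : ∀ i, (quotGrading hI).degMap i (Ideal.Quotient.mk I f)
      = ((α i : ℤ) : ℂ) • Ideal.Quotient.mk I f :=
    fun i => (quotGrading hI).degMap_of_mem i ⟨f, hf, rfl⟩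
  have hX : ∀ j, (Weyl.x j * Weyl.del j) ⊗ₜ[R n] Ideal.Quotient.mk I f
      = Weyl.x j ⊗ₜ[R n] Ideal.Quotient.mk I (X j * f) := by
    intro j
    rw [← Weyl.ofPoly_X, ← Weyl.smul_def, TensorProduct.smul_tmul]
    rfl
  have h1 : ∀ i, eulerEnd β (quotGrading hI) i ((1 : Weyl n) ⊗ₜ[R n] Ideal.Quotient.mk I f)
      = ∑ j, (A i j : ℂ) • (Weyl.x j ⊗ₜ[R n] Ideal.Quotient.mk I (X j * f))
        - (β i + (α i : ℂ)) • ((1 : Weyl n) ⊗ₜ[R n] Ideal.Quotient.mk I f) := by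
    intro i
    rw [eulerEnd_tmul, hdeg, one_mul, eulerSub, euler, TensorProduct.sub_tmul,
      TensorProduct.sum_tmul, TensorProduct.tmul_smul, Algebra.algebraMap_eq_smul_one, add_smul]
    simp only [← TensorProduct.smul_tmul', hX]
    abel
  simp only [LinearMap.sum_apply, LinearMap.smul_apply, h1, smul_sub, Finset.sum_sub_distrib,
    Finset.smul_sum, Finset.sum_smul, smul_smul]
  rw [Finset.sum_comm]

/-- A `D`-linear endomorphism of `D ⊗ R/I` annihilates the image of `D ⊗ L`. -/
def Annihilates (I L : Ideal (R n)) (ψ : Module.End (Weyl n) (Weyl n ⊗[R n] (R n ⧸ I))) : Prop :=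
  ∀ f ∈ L, ψ ((1 : Weyl n) ⊗ₜ[R n] Ideal.Quotient.mk I f) = 0

theorem Annihilates.apply_tmul {L : Ideal (R n)}
    {ψ : Module.End (Weyl n) (Weyl n ⊗[R n] (R n ⧸ I))} (h : Annihilates I L ψ) (a : Weyl n)
    {f : R n} (hf : f ∈ L) : ψ (a ⊗ₜ[R n] Ideal.Quotient.mk I f) = 0 := by
  have h1 : a ⊗ₜ[R n] Ideal.Quotient.mk I f
      = a • ((1 : Weyl n) ⊗ₜ[R n] Ideal.Quotient.mk I f) := by
    rw [TensorProduct.smul_tmul', smul_eq_mul, mul_one]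
  rw [h1, map_smul, h f hf, smul_zero]

theorem Annihilates.sup_span_singleton {L : Ideal (R n)} {f : R n}
    {ψ : Module.End (Weyl n) (Weyl n ⊗[R n] (R n ⧸ I))} (h : Annihilates I L ψ)
    (hf : ψ ((1 : Weyl n) ⊗ₜ[R n] Ideal.Quotient.mk I f) = 0) :
    Annihilates I (L ⊔ Ideal.span {f}) ψ := by
  intro p hp
  obtain ⟨q, hq, r, hr, rfl⟩ := Submodule.mem_sup.1 hp
  obtain ⟨s, rfl⟩ := Ideal.mem_span_singleton'.1 hr
  have h1 : (1 : Weyl n) ⊗ₜ[R n] Ideal.Quotient.mk I (s * f)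
      = Weyl.ofPoly s • ((1 : Weyl n) ⊗ₜ[R n] Ideal.Quotient.mk I f) := by
    rw [TensorProduct.smul_tmul', smul_eq_mul, mul_one,
      show Ideal.Quotient.mk I (s * f) = s • Ideal.Quotient.mk I f from rfl,
      ← TensorProduct.smul_tmul, Weyl.smul_def, one_mul]
  rw [map_add, TensorProduct.tmul_add, map_add, h q hq, h1, map_smul, hf, smul_zero, add_zero]

theorem weylTensorMap_quotMap_surjective (h : I ≤ K) :
    Function.Surjective (weylTensorMap (quotMap h)) :=
  LinearMap.lTensor_surjective _ (Submodule.factor_surjective h)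

theorem Annihilates.apply_eq_zero (h : I ≤ K)
    {ψ : Module.End (Weyl n) (Weyl n ⊗[R n] (R n ⧸ I))} (hψ : Annihilates I K ψ)
    (t : Weyl n ⊗[R n] (R n ⧸ I)) (ht : weylTensorMap (quotMap h) t = 0) : ψ t = 0 := by
  have hex := lTensor_exact (Weyl n) (LinearMap.exact_subtype_ker_map (quotMap h))
    (Submodule.factor_surjective h)
  obtain ⟨s, rfl⟩ := (hex t).1 ht
  induction s using TensorProduct.induction_on with
  | zero => simp
  | tmul a v =>
    obtain ⟨v, hv⟩ := v
    obtain ⟨f, rfl⟩ := Ideal.Quotient.mk_surjective v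
    have hf : f ∈ K := Ideal.Quotient.eq_zero_iff_mem.1 hv
    exact hψ.apply_tmul a hf
  | add s t hs ht' =>
    rw [map_add, map_add, hs ((hex _).2 ⟨s, rfl⟩), ht' ((hex _).2 ⟨t, rfl⟩), add_zero]

variable {κ : Type} [Finite κ] (𝒞 : BinomialPrimaryDecomposition A I κ) (hI : IsAGraded A I)

/-- Some polynomial in the Euler operators with constant term `1` annihilates the image of
`D ⊗ I_β` in `D ⊗ R/I`. It is a product of affine linear factors, one for each step of an
ascending chain of ideals from `I` to `I_β`. -/
theorem exists_isUnitalPair_annihilates :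
    ∃ ψ ψ', IsUnitalPair (eulerEnd β (quotGrading hI))
        (eulerEnd β (quotGrading (𝒞.idealAt_isAGraded β)))
        (weylTensorMap (quotMap (𝒞.le_idealAt β))) ψ ψ' ∧
      Annihilates I (𝒞.idealAt β) ψ := by
  obtain ⟨g, hgβ, hg⟩ := 𝒞.exists_eval_eq_zero_on_tdeg β
  set φ := eulerEnd β (quotGrading hI) with hφ
  set φ' := eulerEnd β (quotGrading (𝒞.idealAt_isAGraded β)) with hφ'
  set G := weylTensorMap (quotMap (𝒞.le_idealAt β)) with hG
  have hGφ : ∀ i m, G (φ i m) = φ' i (G m) :=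
    weylTensorMap_eulerEnd β (quotMap_isGradedHom hI (𝒞.idealAt_isAGraded β) (𝒞.le_idealAt β))
  have main : ∀ L : Ideal (R n), I ≤ L → L ≤ 𝒞.idealAt β →
      (∃ ψ ψ', IsUnitalPair φ φ' G ψ ψ' ∧ Annihilates I L ψ) →
      ∃ ψ ψ', IsUnitalPair φ φ' G ψ ψ' ∧ Annihilates I (𝒞.idealAt β) ψ := by
    intro L
    induction L using WellFoundedGT.induction with
    | ind L ih =>
    rintro hIL hLK ⟨ψ, ψ', hψ, hann⟩
    by_cases hKL : 𝒞.idealAt β ≤ L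
    · exact ⟨ψ, ψ', hψ, fun f hf => hann f (hKL hf)⟩
    obtain ⟨f, hfK, hfL, ⟨α, hfα⟩, hmon⟩ :=
      exists_homogeneous_monomial_mul_notMem (𝒞.idealAt_isAGraded β) hKL
    obtain ⟨l, hl, hc⟩ := exists_linear_functional_of_eval_eq_zero A β α {j | X j * f ∉ L} g
      (fun u hu => by
        have h1 := hmon u fun j hj => hu j (not_not_intro hj)
        -- The monomial multiple of `f` is nonzero in some `R/C_k` with `-β ∉ qdeg (R/C_k)`.
        obtain ⟨k, hk, hfk⟩ := 𝒞.exists_notMem_of_mem_idealAt β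
          (Ideal.mul_mem_left _ _ hfK) (fun h => h1 (hIL h))
        exact hg k hk _ (mem_tdeg_quotGrading _ (monomial_mul_mem_polyPiece hfα u) hfk)) hgβ
    set c := ∑ i, l i * (β i + (α i : ℂ)) with hcdef
    -- The linear factor `c⁻¹ (c + ∑ lᵢ (Eᵢ - βᵢ))` sends `1 ⊗ f` into the image of `D ⊗ L`.
    have hχ : IsUnitalPair φ φ' G (1 + ∑ i, φ i * ((c⁻¹ * l i) • 1))
        (1 + ∑ i, φ' i * ((c⁻¹ * l i) • 1)) :=
      ⟨fun i => (c⁻¹ * l i) • 1, fun i => (c⁻¹ * l i) • 1,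
        fun k i => (Commute.one_left _).smul_left _, fun k i => (Commute.one_left _).smul_left _,
        fun k m => by
          simp only [LinearMap.smul_apply, Module.End.one_apply]
          rw [← algebraMap_smul (Weyl n) (c⁻¹ * l k) m, map_smul, algebraMap_smul], rfl, rfl⟩
    refine ih (L ⊔ Ideal.span {f}) ?_ (hIL.trans le_sup_left)
      (sup_le hLK ((Ideal.span_singleton_le_iff_mem _).2 hfK))
      ⟨_, _, hψ.mul (eulerEnd_comm β _) (eulerEnd_comm β _) hGφ hχ, ?_⟩
    · refine lt_of_le_of_ne le_sup_left fun h => hfL ?_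
      rw [h]
      exact Ideal.mem_sup_right (Ideal.mem_span_singleton_self f)
    · obtain ⟨q, q', hq, -, -, hψq, -⟩ := hψ
      have hcomm : ∀ i, Commute ψ (φ i) := fun i =>
        hψq ▸ commute_one_add_sum (eulerEnd_comm β _) hq i
      have hψχ : Commute ψ (1 + ∑ i, φ i * ((c⁻¹ * l i) • 1)) :=
        (Commute.one_right _).add_right (Commute.sum_right _ _ _ fun i _ =>
          (hcomm i).mul_right ((Commute.one_right _).smul_right _))
      refine Annihilates.sup_span_singleton (fun p hp => ?_) ?_
      · rw [hψχ.eq, Module.End.mul_apply, hann p hp, map_zero]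
      · have hχ' : 1 + ∑ i, φ i * ((c⁻¹ * l i) • 1) = 1 + c⁻¹ • ∑ i, l i • φ i := by
          simp only [Finset.smul_sum, mul_smul_comm, mul_one, smul_smul]
        rw [Module.End.mul_apply, hχ', LinearMap.add_apply, LinearMap.smul_apply,
          sum_smul_eulerEnd_one_tmul β hI l hfα, ← hcdef, smul_sub, smul_smul,
          inv_mul_cancel₀ hc, one_smul, Module.End.one_apply, add_sub_cancel,
          ← algebraMap_smul (Weyl n) c⁻¹, map_smul, map_sum, Finset.sum_eq_zero, smul_zero]
        intro j _
        rw [← algebraMap_smul (Weyl n), map_smul]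
        by_cases hj : X j * f ∈ L
        · rw [hann.apply_tmul _ hj, smul_zero]
        · rw [hl j hj, map_zero, zero_smul]
  exact main I le_rfl (𝒞.le_idealAt β) ⟨1, 1, IsUnitalPair.one, fun f hf => by
    rw [Ideal.Quotient.eq_zero_iff_mem.2 hf, TensorProduct.tmul_zero, map_zero]⟩

end Annihilation

variable {I : Ideal (R n)}

/-! ### The hypergeometric ideal -/

theorem euler_mul_ofPoly_monomial (i : Fin d) (u : Fin n →₀ ℕ) :
    euler A i * Weyl.ofPoly (monomial u 1) = Weyl.ofPoly (monomial u 1) * euler A i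
      + (∑ j, -(A i j : ℂ) * u j) • Weyl.ofPoly (monomial u 1) := by
  induction u using Finsupp.induction_linear with
  | zero => simp
  | add u v hu hv =>
    have h : Weyl.ofPoly (monomial (u + v) (1 : ℂ))
        = Weyl.ofPoly (monomial u 1) * Weyl.ofPoly (monomial v 1) := by
      rw [← map_mul, monomial_mul, one_mul]
    rw [h, ← mul_assoc, hu, add_mul, mul_assoc, hv]
    simp only [mul_add, smul_mul_assoc, mul_smul_comm, mul_assoc, add_assoc, ← add_smul,
      ← Finset.sum_add_distrib, Finsupp.add_apply, Nat.cast_add]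
    simp only [add_comm]
  | single j m =>
    classical
    have h : Weyl.ofPoly (monomial (Finsupp.single j m) (1 : ℂ)) = Weyl.del j ^ m := by
      rw [← X_pow_eq_monomial, map_pow, Weyl.ofPoly_X]
    rw [h, euler_mul_del_pow, Finset.sum_eq_single j]
    · simp
    · intro k _ hk
      simp [Finsupp.single_eq_of_ne hk]
    · simp

theorem euler_mul_ofPoly (i : Fin d) {α : Fin d → ℤ} {f : R n} (hf : f ∈ polyPiece A α) :
    euler A i * Weyl.ofPoly f = Weyl.ofPoly f * euler A i + (α i : ℂ) • Weyl.ofPoly f := by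
  have hsum : Weyl.ofPoly f = ∑ u ∈ f.support, f.coeff u • Weyl.ofPoly (monomial u 1) := by
    conv_lhs => rw [f.as_sum, map_sum]
    refine Finset.sum_congr rfl fun u _ => ?_
    rw [← map_smul, smul_monomial, smul_eq_mul, mul_one]
  rw [hsum, Finset.mul_sum, Finset.sum_mul, Finset.smul_sum, ← Finset.sum_add_distrib]
  refine Finset.sum_congr rfl fun u hu => ?_
  have hα : (∑ j, -(A i j : ℂ) * u j) = α i := by
    rw [← hf (mem_support_iff.1 hu), Finsupp.weight_apply, Finsupp.sum_fintype _ _ (by simp)]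
    simp [mul_comm]
  rw [mul_smul_comm, euler_mul_ofPoly_monomial, hα, smul_add, smul_mul_assoc, smul_comm]

/-- The additive map `D ⊗ R/I → M_A(I, β)`, `a ⊗ f ↦ a f`. It is
recorded only as a homomorphism of additive groups. -/
noncomputable def tensorToDModule (A : Matrix (Fin d) (Fin n) ℤ) (I : Ideal (R n)) (β : Fin d → ℂ) :
    Weyl n ⊗[R n] (R n ⧸ I) →+ binomialDModule A I β :=
  TensorProduct.liftAddHom
    (AddMonoidHom.mk' (fun a => QuotientAddGroup.lift I.toAddSubgroup
        ((hypergeometricIdeal A I β).mkQ.toAddMonoidHom.comp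
          ((AddMonoidHom.mulLeft a).comp (Weyl.ofPoly (n := n)).toRingHom.toAddMonoidHom))
        fun f hf => (Submodule.Quotient.mk_eq_zero _).2
          (Submodule.smul_mem _ a (Submodule.subset_span (Or.inl ⟨f, hf, rfl⟩))))
      fun a b => by
        refine AddMonoidHom.ext fun v => ?_
        obtain ⟨f, rfl⟩ := Ideal.Quotient.mk_surjective v
        exact congrArg (hypergeometricIdeal A I β).mkQ (add_mul a b (Weyl.ofPoly f)))
    fun r a v => by
      obtain ⟨f, rfl⟩ := Ideal.Quotient.mk_surjective v
      refine congrArg (hypergeometricIdeal A I β).mkQ ?_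
      change a * Weyl.ofPoly r * Weyl.ofPoly f = a * Weyl.ofPoly (r * f)
      rw [map_mul, mul_assoc]

theorem tensorToDModule_tmul (β : Fin d → ℂ) (a : Weyl n) (f : R n) :
    tensorToDModule A I β (a ⊗ₜ[R n] Ideal.Quotient.mk I f)
      = Submodule.Quotient.mk (a * Weyl.ofPoly f) := rfl

theorem tensorToDModule_eulerEnd (hI : IsAGraded A I) (β : Fin d → ℂ) (i : Fin d)
    (t : Weyl n ⊗[R n] (R n ⧸ I)) :
    tensorToDModule A I β (eulerEnd β (quotGrading hI) i t) = 0 := by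
  induction t using TensorProduct.induction_on with
  | zero => simp
  | add s t hs ht => rw [map_add, map_add, hs, ht, add_zero]
  | tmul a v =>
    refine (quotGrading hI).induction_on
      (fun v => tensorToDModule A I β (eulerEnd β (quotGrading hI) i (a ⊗ₜ v)) = 0) v ?_ ?_ ?_
    · simp
    · intro u w hu hw
      rw [TensorProduct.tmul_add, map_add, map_add, hu, hw, add_zero]
    · rintro α _ ⟨f, hf, rfl⟩
      have hdeg : (quotGrading hI).degMap i (Ideal.Quotient.mk I f)
          = (α i : ℂ) • Ideal.Quotient.mk I f :=
        (quotGrading hI).degMap_of_mem i ⟨f, hf, rfl⟩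
      change tensorToDModule A I β
        (eulerEnd β (quotGrading hI) i (a ⊗ₜ Ideal.Quotient.mk I f)) = 0
      rw [eulerEnd_tmul, hdeg, TensorProduct.tmul_smul, TensorProduct.smul_tmul', map_sub,
        tensorToDModule_tmul, tensorToDModule_tmul, ← Submodule.Quotient.mk_sub,
        Submodule.Quotient.mk_eq_zero]
      have h : a * eulerSub A β i * Weyl.ofPoly f - ((α i : ℂ) • a) * Weyl.ofPoly f
          = (a * Weyl.ofPoly f) • eulerSub A β i := by
        rw [smul_eq_mul, eulerSub, mul_assoc, sub_mul, euler_mul_ofPoly i hf,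
          Algebra.commutes (β i) (Weyl.ofPoly f)]
        simp only [mul_sub, mul_add, smul_mul_assoc, mul_smul_comm, mul_assoc]
        abel
      rw [h]
      exact Submodule.smul_mem _ _ (Submodule.subset_span (Or.inr ⟨i, rfl⟩))

/-- If a polynomial `1 + ∑ φ_k q_k` in the Euler operators `φ` annihilates `1 ⊗ f`, then `1 ⊗ f`
is in the image of the `φ_k`, so that `f` lies in `D I + D (E - β)`. -/
theorem hypergeometricIdeal_eq_of_annihilates {K : Ideal (R n)} (hI : IsAGraded A I) (h : I ≤ K)
    (β : Fin d → ℂ) (q : Fin d → Module.End (Weyl n) (Weyl n ⊗[R n] (R n ⧸ I)))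
    (hann : Annihilates I K (1 + ∑ k, eulerEnd β (quotGrading hI) k * q k)) :
    hypergeometricIdeal A I β = hypergeometricIdeal A K β := by
  refine le_antisymm (Submodule.span_mono (Set.union_subset_union_left _ (Set.image_mono h)))
    (Submodule.span_le.2 ?_)
  rintro _ (⟨f, hf, rfl⟩ | ⟨i, rfl⟩)
  · have h1 := congrArg (tensorToDModule A I β) (hann f hf)
    simp only [LinearMap.add_apply, Module.End.one_apply, LinearMap.sum_apply,
      Module.End.mul_apply, map_add, map_sum, tensorToDModule_eulerEnd, Finset.sum_const_zero,
      add_zero, map_zero, tensorToDModule_tmul, one_mul] at h1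
    exact (Submodule.Quotient.mk_eq_zero _).1 h1
  · exact Submodule.subset_span (Or.inr ⟨i, rfl⟩)

end EulerKoszul

theorem proposition3p2 {d n : ℕ} (A : Matrix (Fin d) (Fin n) ℤ) (hA : IsPointedSpanning A)
    (I : Ideal (R n)) (hbin : IsBinomial I) (hI : IsAGraded A I)
    {κ : Type} [Finite κ] (𝒞 : BinomialPrimaryDecomposition A I κ)
    (β : Fin d → ℂ) (hβ : -β ∉ 𝒞.andeanArrangement) :
    (∀ i : ℕ, IsIso (eulerKoszulHomologyMap β
      (quotMap_isGradedHom hI (𝒞.idealAt_isAGraded β) (𝒞.le_idealAt β)) i)) ∧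
    ∃ e : binomialDModule A I β ≃ₗ[Weyl n] binomialDModule A (𝒞.idealAt β) β,
      ∀ P : Weyl n, e (Submodule.Quotient.mk P) = Submodule.Quotient.mk P := by
  obtain ⟨ψ, ψ', hψ, hann⟩ := exists_isUnitalPair_annihilates β 𝒞 hI
  refine ⟨fun i => hψ.isIso_homologyMap (eulerEnd_comm β _) (eulerEnd_comm β _) _
    (weylTensorMap_quotMap_surjective _) (hann.apply_eq_zero (𝒞.le_idealAt β)) i, ?_⟩
  obtain ⟨q, q', -, -, -, rfl, -⟩ := hψ
  exact ⟨Submodule.quotEquivOfEq _ _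
    (hypergeometricIdeal_eq_of_annihilates hI (𝒞.le_idealAt β) β q hann), fun P => rfl⟩
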